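/- Logarithms are to base $2$, with $0\log(\cdot)=0$. For a string $s$ of length $n$ over an alphabet of size $\sigma$, let $H_0(s)=\sum_a \frac{\mathrm{occ}(a,s)}{n}\log\frac{n}{\mathrm{occ}(a,s)}$, where $\mathrm{occ}(a,s)$ is the number of occurrences of the character $a$ in $s$, and for $k\ge 1$ let $H_k(s)=\frac1n\sum_{|w|=k}|w_s|\,H_0(w_s)$, where $w_s$ is the concatenation of the characters that immediately follow the occurrences of the $k$-tuple $w$ in $s$ (empirical entropies of the empty string are $0$). A one-pass program is a fixed program, built from assignments of arithmetic expressions (with $+,-,\times,\div,\bmod$), sequencing, tests and while-loops, over finitely many registers that hold natural numbers. It reads each symbol of its input stream only once, from left to right (being told when the input has ended), and appends symbols to a write-only output stream. Its memory usage is the largest number of bits that its registers and the intermediate values of the expressions being evaluated take, in binary, at any time of the computation (the initial parameters included; the input and output streams are not counted). **Theorem.** Let $\lambda\ge 1$ and $\mu>0$ be real constants and $k\ge 0$ an integer constant. There are a one-pass compressor and a one-pass decompressor, depending only on $\lambda,k,\mu$, such that the following holds for every alphabet size $\sigma\ge 2$ and every string $s$ of any length $n\ge0$ over an alphabet of size $\sigma$.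 Both programs are given the parameters $\sigma$ and $\lceil\sigma^{1/\lambda}\rceil$, but not $n$. The compressor, reading $s$, halts and outputs a bit string of length at most $$(\lambda H_k(s)+\mu)\,n+O\!\left(\sigma^{k+1/\lambda}\log\sigma\right)$$ using one pass and $O\!\left(\sigma^{k+1/\lambda}\log^2\sigma\right)$ bits of memory; and the decompressor, reading that bit string, halts and outputs exactly $s$, using one pass and $O\!\left(\sigma^{k+1/\lambda}\log^2\sigma\right)$ bits of memory. The constants hidden in the $O$-notation depend only on $\lambda,k,\mu$ (not on $\sigma$, $n$ or $s$). -/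

import Mathlib

namespace OnePass

/-! ### Empirical entropy of strings over the alphabet `Fin σ` -/

/-- The `0`th-order empirical entropy
`H₀(s) = ∑ₐ (occ(a, s) / n) log₂ (n / occ(a, s))`, where `n` is the length of `s`
(characters that do not occur contribute `0`; the empty string has entropy `0`). -/
noncomputable def entropy0 {σ : ℕ} (s : List (Fin σ)) : ℝ :=
  ∑ a : Fin σ, ((s.count a : ℝ) / (s.length : ℝ)) *
    Real.logb 2 ((s.length : ℝ) / (s.count a : ℝ))

/-- `w_s`: the concatenation, from left to right, of the characters that immediately follow
the (possibly overlapping) occurrences of `w` in `s`. -/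
def followers {σ : ℕ} (w s : List (Fin σ)) : List (Fin σ) :=
  s.tails.filterMap fun t => if w <+: t then t[w.length]? else none

/-- The `k`th-order empirical entropy: `H₀(s)` if `k = 0`, and
`(1 / n) ∑_{|w| = k} |w_s| H₀(w_s)` otherwise. -/
noncomputable def entropy {σ : ℕ} (k : ℕ) (s : List (Fin σ)) : ℝ :=
  if k = 0 then entropy0 s
  else (1 / (s.length : ℝ)) * ∑ w : Fin k → Fin σ,
    ((followers (List.ofFn w) s).length : ℝ) * entropy0 (followers (List.ofFn w) s)

/-! ### One-pass programs and the bits of memory that they use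

A program works on finitely many registers that hold natural numbers. It reads its input stream
once, from left to right, and it appends to a write-only output stream. Nothing but the registers
and the fixed program text survives from one instruction to the next. A number takes as many bits
of memory as its binary representation has digits. -/

/-- The contents of `m` registers. -/
abbrev Mem (m : ℕ) : Type := Fin m → ℕ

/-- The number of bits held in the registers (`Nat.size` is the length of the binary
representation). -/
def Mem.bits {m : ℕ} (v : Mem m) : ℕ := ∑ i : Fin m, (v i).size

/-- The memory that holds the given parameters in its first registers and `0` elsewhere. -/
def Mem.init (m : ℕ) (params : List ℕ) : Mem m := fun i => params.getD i 0

/-- Arithmetic expressions in the registers. -/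
inductive Expr (m : ℕ) : Type
  | const (c : ℕ) : Expr m
  | reg (x : Fin m) : Expr m
  | add (e f : Expr m) : Expr m
  | sub (e f : Expr m) : Expr m
  | mul (e f : Expr m) : Expr m
  | div (e f : Expr m) : Expr m
  | mod (e f : Expr m) : Expr m

/-- The value of an expression (truncated subtraction, rounded division). -/
def Expr.eval {m : ℕ} (v : Mem m) : Expr m → ℕ
  | .const c => c
  | .reg x => v x
  | .add e f => e.eval v + f.eval v
  | .sub e f => e.eval v - f.eval v
  | .mul e f => e.eval v * f.eval v
  | .div e f => e.eval v / f.eval v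
  | .mod e f => e.eval v % f.eval v

/-- The number of bits charged for evaluating an expression: the total binary length of the values
of all its subexpressions. -/
def Expr.bits {m : ℕ} (v : Mem m) : Expr m → ℕ
  | .const c => c.size
  | .reg x => (v x).size
  | .add e f => e.bits v + f.bits v + (e.eval v + f.eval v).size
  | .sub e f => e.bits v + f.bits v + (e.eval v - f.eval v).size
  | .mul e f => e.bits v + f.bits v + (e.eval v * f.eval v).size
  | .div e f => e.bits v + f.bits v + (e.eval v / f.eval v).size
  | .mod e f => e.bits v + f.bits v + (e.eval v % f.eval v).size

/-- Programs. A test succeeds if its expression is not `0`. -/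
inductive Prog (m : ℕ) : Type
  | skip : Prog m
  | assign (x : Fin m) (e : Expr m) : Prog m
  | read (x : Fin m) : Prog m
  | write (e : Expr m) : Prog m
  | seq (p q : Prog m) : Prog m
  | ite (e : Expr m) (p q : Prog m) : Prog m
  | loop (e : Expr m) (p : Prog m) : Prog m

/-- `Exec b p v i v' i' o`: started with memory `v` and remaining input `i`, the program `p`
terminates with memory `v'` and remaining input `i'`, after appending `o` to the output, and none
of its steps uses more than `b` bits of memory.

`read x` consumes the next input symbol `a` and sets `x` to `a + 1`; at the end of the input it
sets `x` to `0`. -/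
inductive Exec {m : ℕ} (b : ℕ) :
    Prog m → Mem m → List ℕ → Mem m → List ℕ → List ℕ → Prop
  | skip (v : Mem m) (i : List ℕ) : Exec b .skip v i v i []
  | assign (x : Fin m) (e : Expr m) (v : Mem m) (i : List ℕ)
      (he : v.bits + e.bits v ≤ b)
      (hb : Mem.bits (Function.update v x (e.eval v)) ≤ b) :
      Exec b (.assign x e) v i (Function.update v x (e.eval v)) i []
  | read_end (x : Fin m) (v : Mem m)
      (hb : Mem.bits (Function.update v x 0) ≤ b) :
      Exec b (.read x) v [] (Function.update v x 0) [] []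
  | read_cons (x : Fin m) (v : Mem m) (a : ℕ) (i : List ℕ)
      (hb : Mem.bits (Function.update v x (a + 1)) ≤ b) :
      Exec b (.read x) v (a :: i) (Function.update v x (a + 1)) i []
  | write (e : Expr m) (v : Mem m) (i : List ℕ)
      (he : v.bits + e.bits v ≤ b) :
      Exec b (.write e) v i v i [e.eval v]
  | seq {p q : Prog m} {v v' v'' : Mem m} {i i' i'' o o' : List ℕ}
      (hp : Exec b p v i v' i' o) (hq : Exec b q v' i' v'' i'' o') :
      Exec b (.seq p q) v i v'' i'' (o ++ o')
  | ite_true {e : Expr m} {p q : Prog m} {v v' : Mem m} {i i' o : List ℕ}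
      (he : v.bits + e.bits v ≤ b) (ht : e.eval v ≠ 0) (hp : Exec b p v i v' i' o) :
      Exec b (.ite e p q) v i v' i' o
  | ite_false {e : Expr m} {p q : Prog m} {v v' : Mem m} {i i' o : List ℕ}
      (he : v.bits + e.bits v ≤ b) (hf : e.eval v = 0) (hq : Exec b q v i v' i' o) :
      Exec b (.ite e p q) v i v' i' o
  | loop_true {e : Expr m} {p : Prog m} {v v' v'' : Mem m} {i i' i'' o o' : List ℕ}
      (he : v.bits + e.bits v ≤ b) (ht : e.eval v ≠ 0)
      (hp : Exec b p v i v' i' o) (hl : Exec b (.loop e p) v' i' v'' i'' o') :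
      Exec b (.loop e p) v i v'' i'' (o ++ o')
  | loop_false {e : Expr m} {p : Prog m} {v : Mem m} {i : List ℕ}
      (he : v.bits + e.bits v ≤ b) (hf : e.eval v = 0) :
      Exec b (.loop e p) v i v i []

/-- Given the parameters in its first registers, the program `p` makes one pass over the stream
`input`, terminates, and has then written exactly the stream `output`, all in at most `b` bits of
memory. -/
def Transforms {m : ℕ} (p : Prog m) (b : ℕ) (params input output : List ℕ) : Prop :=
  (Mem.init m params).bits ≤ b ∧
    ∃ (v : Mem m) (rest : List ℕ), Exec b p (Mem.init m params) input v rest output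

/-- A string over `Fin σ` as a stream of numbers. -/
def charStream {σ : ℕ} (s : List (Fin σ)) : List ℕ := s.map fun a => (a : ℕ)

/-- A bit string as a stream of numbers. -/
def bitStream (c : List Bool) : List ℕ := c.map Bool.toNat

end OnePass

namespace OnePass

/-! ### Executions in which all registers stay below a bound -/

/-! The string is cut into blocks of length `B`, of order `σ^k * r * log σ` with `r = ⌈σ^(1/λ)⌉`,
and each block is coded independently by its rank among all strings of its length, sorted by
decreasing adaptive probability. Running time is not limited, so both programs can recompute ranks
by exhaustive enumeration, and the decoder inverts the rank by trying all blocks. Only the current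
block and a few numbers of comparable size are stored.

The adaptive probability smooths the counts: after a context seen `N` times, `t` of them followed by
`a`, the next character is `a` with probability `(t + r/σ)/(N + r)`. These sum to 1 over `a`
(`sum_prob`), so a block of probability `p` has `rank + 1 ≤ σ^k / p`, the first `k` characters being
free (`rank_succ_mul_prob_le`). The probability is a product of urn probabilities, one per context
(`strProb_eq_prod`). The negative logarithm of an urn exceeds the empirical entropy of its counts by
`r log(N + r)` plus `log(σ t/r)` for each character that occurs (`neg_log_urnProb_le`).

The last term is where `λ` enters (`exists_frequent_bound`). A character rarer than `1/(c r)`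
already costs at least `log(c r)` bits per occurrence in the entropy, and `(λ - 1) log r ≥ log(σ/r)`
because `r ≥ σ^(1/λ)`; so the extra `(λ - 1)` times the entropy pays for it. At most `c r`
characters are more frequent, and they go into the overhead `O(σ^k r log σ)` of the block.

Entropy is superadditive under concatenation (`contextEntropy_add_le`), so the blocks together cost
no more than `λ n H_k(s)` plus overheads. With `B` a large enough multiple of the overhead, each
full block hides its overhead in `μ B`, and only the last block contributes an additive term. The
last block is always shorter than `B`, possibly empty, which marks the end without knowing `n`.
Every stored number has `O(B log σ)` bits, which is the memory bound. -/

/-- The number of leaves of an expression. -/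
def Expr.leaves {m : ℕ} : Expr m → ℕ
  | .const _ => 1
  | .reg _ => 1
  | .add e f => e.leaves + f.leaves
  | .sub e f => e.leaves + f.leaves
  | .mul e f => e.leaves + f.leaves
  | .div e f => e.leaves + f.leaves
  | .mod e f => e.leaves + f.leaves

/-- The bit cost of an expression in multiples of the binary length of a bound on the registers. -/
def Expr.cost {m : ℕ} : Expr m → ℕ
  | .const _ => 1
  | .reg _ => 1
  | .add e f => e.cost + f.cost + (e.leaves + f.leaves)
  | .sub e f => e.cost + f.cost + (e.leaves + f.leaves)
  | .mul e f => e.cost + f.cost + (e.leaves + f.leaves)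
  | .div e f => e.cost + f.cost + (e.leaves + f.leaves)
  | .mod e f => e.cost + f.cost + (e.leaves + f.leaves)

/-- The largest constant of an expression. -/
def Expr.maxConst {m : ℕ} : Expr m → ℕ
  | .const c => c
  | .reg _ => 0
  | .add e f => max e.maxConst f.maxConst
  | .sub e f => max e.maxConst f.maxConst
  | .mul e f => max e.maxConst f.maxConst
  | .div e f => max e.maxConst f.maxConst
  | .mod e f => max e.maxConst f.maxConst

/-- The largest cost of an expression of a program. -/
def Prog.cost {m : ℕ} : Prog m → ℕ
  | .skip => 0
  | .assign _ e => e.cost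
  | .read _ => 0
  | .write e => e.cost
  | .seq p q => max p.cost q.cost
  | .ite e p q => max e.cost (max p.cost q.cost)
  | .loop e p => max e.cost p.cost

/-- The largest constant of a program. -/
def Prog.maxConst {m : ℕ} : Prog m → ℕ
  | .skip => 0
  | .assign _ e => e.maxConst
  | .read _ => 0
  | .write e => e.maxConst
  | .seq p q => max p.maxConst q.maxConst
  | .ite e p q => max e.maxConst (max p.maxConst q.maxConst)
  | .loop e p => max e.maxConst p.maxConst

theorem Expr.leaves_pos {m : ℕ} (e : Expr m) : 0 < e.leaves := by
  induction e <;> simp [Expr.leaves] <;> omega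

/-- Numbers that are at least 2 have a sum at most their product, so sums may be bounded like
products; the other operations never exceed their left operand. -/
theorem Expr.eval_le_pow {m N : ℕ} (hN : 2 ≤ N) {v : Mem m} (hv : ∀ j, v j ≤ N) (e : Expr m)
    (hc : e.maxConst ≤ N) : e.eval v ≤ N ^ e.leaves := by
  have two_le : ∀ f : Expr m, 2 ≤ N ^ f.leaves := fun f =>
    hN.trans (Nat.le_self_pow f.leaves_pos.ne' N)
  induction e with
  | const c => simpa [Expr.leaves, Expr.eval, Expr.maxConst] using hc
  | reg x => simpa [Expr.leaves, Expr.eval] using hv x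
  | add e f he hf =>
    simp only [Expr.maxConst, max_le_iff] at hc
    simp only [Expr.eval, Expr.leaves, pow_add]
    exact (add_le_add (he hc.1) (hf hc.2)).trans (Nat.add_le_mul (two_le e) (two_le f))
  | sub e f he hf =>
    simp only [Expr.maxConst, max_le_iff] at hc
    simp only [Expr.eval, Expr.leaves, pow_add]
    exact (Nat.sub_le _ _).trans ((he hc.1).trans (Nat.le_mul_of_pos_right _ (by have := two_le f; omega)))
  | mul e f he hf =>
    simp only [Expr.maxConst, max_le_iff] at hc
    simp only [Expr.eval, Expr.leaves, pow_add]
    exact Nat.mul_le_mul (he hc.1) (hf hc.2)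
  | div e f he hf =>
    simp only [Expr.maxConst, max_le_iff] at hc
    simp only [Expr.eval, Expr.leaves, pow_add]
    exact (Nat.div_le_self _ _).trans
      ((he hc.1).trans (Nat.le_mul_of_pos_right _ (by have := two_le f; omega)))
  | mod e f he hf =>
    simp only [Expr.maxConst, max_le_iff] at hc
    simp only [Expr.eval, Expr.leaves, pow_add]
    exact (Nat.mod_le _ _).trans
      ((he hc.1).trans (Nat.le_mul_of_pos_right _ (by have := two_le f; omega)))

theorem size_pow_le (N a : ℕ) (ha : 0 < a) : (N ^ a).size ≤ a * N.size := by
  rw [Nat.size_le, mul_comm, pow_mul]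
  exact Nat.pow_lt_pow_left (Nat.lt_size_self N) ha.ne'

/-- Each subexpression is at most `N` to the number of its leaves, and `cost` adds these exponents
over all nodes. -/
theorem Expr.bits_le {m N : ℕ} (hN : 2 ≤ N) {v : Mem m} (hv : ∀ j, v j ≤ N) (e : Expr m)
    (hc : e.maxConst ≤ N) : e.bits v ≤ e.cost * N.size := by
  have key : ∀ f : Expr m, f.maxConst ≤ N → (f.eval v).size ≤ f.leaves * N.size := fun f hf =>
    (Nat.size_le_size (f.eval_le_pow hN hv hf)).trans (size_pow_le N _ f.leaves_pos)
  induction e with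
  | const c => simpa [Expr.bits, Expr.cost, Expr.maxConst] using Nat.size_le_size (show c ≤ N from hc)
  | reg x => simpa [Expr.bits, Expr.cost] using Nat.size_le_size (hv x)
  | add e f he hf | sub e f he hf | mul e f he hf | div e f he hf | mod e f he hf =>
    have h := key _ hc
    simp only [Expr.maxConst, max_le_iff] at hc
    simp only [Expr.bits, Expr.cost, add_mul]
    simp only [Expr.eval, Expr.leaves, add_mul] at h
    have h1 := he hc.1
    have h2 := hf hc.2
    omega

theorem Mem.bits_le {m N : ℕ} {v : Mem m} (hv : ∀ j, v j ≤ N) : v.bits ≤ m * N.size := by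
  unfold Mem.bits
  calc ∑ i : Fin m, (v i).size ≤ ∑ _i : Fin m, N.size :=
        Finset.sum_le_sum fun i _ => Nat.size_le_size (hv i)
    _ = m * N.size := by simp

/-- Executions in which every value stored in a register is at most `N`. -/
inductive Run {m : ℕ} (N : ℕ) :
    Prog m → Mem m → List ℕ → Mem m → List ℕ → List ℕ → Prop
  | skip (v : Mem m) (i : List ℕ) : Run N .skip v i v i []
  | assign (x : Fin m) (e : Expr m) (v : Mem m) (i : List ℕ) (h : e.eval v ≤ N) :
      Run N (.assign x e) v i (Function.update v x (e.eval v)) i []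
  | read_end (x : Fin m) (v : Mem m) : Run N (.read x) v [] (Function.update v x 0) [] []
  | read_cons (x : Fin m) (v : Mem m) (a : ℕ) (i : List ℕ) (h : a + 1 ≤ N) :
      Run N (.read x) v (a :: i) (Function.update v x (a + 1)) i []
  | write (e : Expr m) (v : Mem m) (i : List ℕ) : Run N (.write e) v i v i [e.eval v]
  | seq {p q : Prog m} {v v' v'' : Mem m} {i i' i'' o o' : List ℕ}
      (hp : Run N p v i v' i' o) (hq : Run N q v' i' v'' i'' o') :
      Run N (.seq p q) v i v'' i'' (o ++ o')
  | ite_true {e : Expr m} {p q : Prog m} {v v' : Mem m} {i i' o : List ℕ}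
      (ht : e.eval v ≠ 0) (hp : Run N p v i v' i' o) : Run N (.ite e p q) v i v' i' o
  | ite_false {e : Expr m} {p q : Prog m} {v v' : Mem m} {i i' o : List ℕ}
      (hf : e.eval v = 0) (hq : Run N q v i v' i' o) : Run N (.ite e p q) v i v' i' o
  | loop_true {e : Expr m} {p : Prog m} {v v' v'' : Mem m} {i i' i'' o o' : List ℕ}
      (ht : e.eval v ≠ 0)
      (hp : Run N p v i v' i' o) (hl : Run N (.loop e p) v' i' v'' i'' o') :
      Run N (.loop e p) v i v'' i'' (o ++ o')
  | loop_false {e : Expr m} {p : Prog m} {v : Mem m} {i : List ℕ}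
      (hf : e.eval v = 0) : Run N (.loop e p) v i v i []

theorem update_le {m N : ℕ} {v : Mem m} (hv : ∀ j, v j ≤ N) (x : Fin m) {a : ℕ} (ha : a ≤ N) :
    ∀ j, Function.update v x a j ≤ N := by
  intro j
  rw [Function.update_apply]
  split_ifs
  exacts [ha, hv j]

theorem Run.le {m N : ℕ} {p : Prog m} {v v' : Mem m} {i i' o : List ℕ}
    (h : Run N p v i v' i' o) (hv : ∀ j, v j ≤ N) : ∀ j, v' j ≤ N := by
  induction h with
  | skip | write | loop_false => exact hv
  | assign x e v i h => exact update_le hv x h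
  | read_end x v => exact update_le hv x (Nat.zero_le N)
  | read_cons x v a i h => exact update_le hv x h
  | seq _ _ h1 h2 => exact h2 (h1 hv)
  | ite_true _ _ h => exact h hv
  | ite_false _ _ h => exact h hv
  | loop_true _ _ _ h1 h2 => exact h2 (h1 hv)

/-- Bounded registers mean bounded memory, up to a factor that depends on the program only. -/
theorem Run.exec {m N b D : ℕ} (hN : 2 ≤ N) (hb : (m + D) * N.size ≤ b) {p : Prog m}
    {v v' : Mem m} {i i' o : List ℕ} (h : Run N p v i v' i' o) (hv : ∀ j, v j ≤ N)
    (hD : p.cost ≤ D) (hc : p.maxConst ≤ N) : Exec b p v i v' i' o := by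
  rw [add_mul] at hb
  have memb : ∀ {v : Mem m}, (∀ j, v j ≤ N) → v.bits ≤ b := fun hv =>
    (Mem.bits_le hv).trans (by omega)
  have expb : ∀ {v : Mem m} {e : Expr m}, (∀ j, v j ≤ N) → e.cost ≤ D → e.maxConst ≤ N →
      v.bits + e.bits v ≤ b := fun {v e} hv hD hc => by
    have h1 := Mem.bits_le hv
    have h2 := e.bits_le hN hv hc
    have h3 := Nat.mul_le_mul_right N.size hD
    omega
  induction h with
  | skip => exact .skip _ _
  | assign x e v i h => exact .assign x e v i (expb hv hD hc) (memb (update_le hv x h))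
  | read_end x v => exact .read_end x v (memb (update_le hv x (Nat.zero_le N)))
  | read_cons x v a i h => exact .read_cons x v a i (memb (update_le hv x h))
  | write e v i => exact .write e v i (expb hv hD hc)
  | seq hp _ h1 h2 =>
    simp only [Prog.cost, Prog.maxConst, max_le_iff] at hD hc
    exact .seq (h1 hv hD.1 hc.1) (h2 (hp.le hv) hD.2 hc.2)
  | ite_true ht _ h =>
    simp only [Prog.cost, Prog.maxConst, max_le_iff] at hD hc
    exact .ite_true (expb hv hD.1 hc.1) ht (h hv hD.2.1 hc.2.1)
  | ite_false ht _ h =>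
    simp only [Prog.cost, Prog.maxConst, max_le_iff] at hD hc
    exact .ite_false (expb hv hD.1 hc.1) ht (h hv hD.2.2 hc.2.2)
  | loop_true ht hp _ h1 h2 =>
    have hD' := hD
    have hc' := hc
    simp only [Prog.cost, Prog.maxConst, max_le_iff] at hD' hc'
    exact .loop_true (expb hv hD'.1 hc'.1) ht (h1 hv hD'.2 hc'.2) (h2 (hp.le hv) hD hc)
  | loop_false hf =>
    simp only [Prog.cost, Prog.maxConst, max_le_iff] at hD hc
    exact .loop_false (expb hv hD.1 hc.1) hf

theorem Run.transforms {m N b D : ℕ} (hN : 2 ≤ N) (hb : (m + D) * N.size ≤ b) {p : Prog m}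
    {v' : Mem m} {params i i' o : List ℕ} (h : Run N p (Mem.init m params) i v' i' o)
    (hv : ∀ j, Mem.init m params j ≤ N) (hD : p.cost ≤ D) (hc : p.maxConst ≤ N) :
    Transforms p b params i o :=
  ⟨(Mem.bits_le hv).trans ((Nat.mul_le_mul_right _ (Nat.le_add_right _ _)).trans hb),
    v', i', h.exec hN hb hv hD hc⟩

theorem Run.seq_nil {m N : ℕ} {p q : Prog m} {v v' v'' : Mem m} {i i' i'' o : List ℕ}
    (hp : Run N p v i v' i' []) (hq : Run N q v' i' v'' i'' o) :
    Run N (.seq p q) v i v'' i'' o := Run.seq hp hq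

theorem Run.seq_out_nil {m N : ℕ} {p q : Prog m} {v v' v'' : Mem m} {i i' i'' o : List ℕ}
    (hp : Run N p v i v' i' o) (hq : Run N q v' i' v'' i'' []) :
    Run N (.seq p q) v i v'' i'' o := by
  simpa using Run.seq hp hq

/-- For loops whose whole memory after `j` rounds is known explicitly. -/
theorem Run.loop_iterate {m N : ℕ} {e : Expr m} {p : Prog m} (st : ℕ → Mem m) (i : List ℕ) (n : ℕ)
    (h : ∀ j < n, e.eval (st j) ≠ 0 ∧ Run N p (st j) i (st (j + 1)) i [])
    (hend : e.eval (st n) = 0) : Run N (.loop e p) (st 0) i (st n) i [] := by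
  induction n generalizing st with
  | zero => exact .loop_false hend
  | succ n ih =>
    exact .loop_true (o := []) (o' := []) (h 0 n.succ_pos).1 (h 0 n.succ_pos).2
      (ih (fun j => st (j + 1)) (fun j hj => h (j + 1) (by omega)) hend)

/-! ### The registers of the block coder -/

/-- The registers. -/
structure St where
  sg : ℕ := 0
  r : ℕ := 0
  sk : ℕ := 0
  L : ℕ := 0
  G : ℕ := 0
  B : ℕ := 0
  x : ℕ := 0
  ln : ℕ := 0
  y : ℕ := 0
  yy : ℕ := 0
  ll : ℕ := 0
  z : ℕ := 0
  c : ℕ := 0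
  t : ℕ := 0
  n : ℕ := 0
  num : ℕ := 0
  den : ℕ := 0
  nx : ℕ := 0
  dx : ℕ := 0
  rk : ℕ := 0
  S : ℕ := 0
  Z : ℕ := 0
  pw : ℕ := 0
  f : ℕ := 0
  go : ℕ := 0

/-- The memory that holds the registers. -/
def St.mem (s : St) : Mem 25 := fun j =>
  [s.sg, s.r, s.sk, s.L, s.G, s.B, s.x, s.ln, s.y, s.yy, s.ll, s.z, s.c, s.t, s.n, s.num, s.den, s.nx, s.dx, s.rk, s.S, s.Z, s.pw, s.f, s.go].getD j 0

namespace Reg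

abbrev sg : Fin 25 := 0
abbrev r : Fin 25 := 1
abbrev sk : Fin 25 := 2
abbrev L : Fin 25 := 3
abbrev G : Fin 25 := 4
abbrev B : Fin 25 := 5
abbrev x : Fin 25 := 6
abbrev ln : Fin 25 := 7
abbrev y : Fin 25 := 8
abbrev yy : Fin 25 := 9
abbrev ll : Fin 25 := 10
abbrev z : Fin 25 := 11
abbrev c : Fin 25 := 12
abbrev t : Fin 25 := 13
abbrev n : Fin 25 := 14
abbrev num : Fin 25 := 15
abbrev den : Fin 25 := 16
abbrev nx : Fin 25 := 17
abbrev dx : Fin 25 := 18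
abbrev rk : Fin 25 := 19
abbrev S : Fin 25 := 20
abbrev Z : Fin 25 := 21
abbrev pw : Fin 25 := 22
abbrev f : Fin 25 := 23
abbrev go : Fin 25 := 24

theorem set_sk (s : St) (a : ℕ) : Function.update s.mem sk a = St.mem { s with sk := a } := by
  funext j; fin_cases j <;> rfl

theorem set_L (s : St) (a : ℕ) : Function.update s.mem L a = St.mem { s with L := a } := by
  funext j; fin_cases j <;> rfl

theorem set_G (s : St) (a : ℕ) : Function.update s.mem G a = St.mem { s with G := a } := by
  funext j; fin_cases j <;> rfl

theorem set_B (s : St) (a : ℕ) : Function.update s.mem B a = St.mem { s with B := a } := by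
  funext j; fin_cases j <;> rfl

theorem set_x (s : St) (a : ℕ) : Function.update s.mem x a = St.mem { s with x := a } := by
  funext j; fin_cases j <;> rfl

theorem set_ln (s : St) (a : ℕ) : Function.update s.mem ln a = St.mem { s with ln := a } := by
  funext j; fin_cases j <;> rfl

theorem set_y (s : St) (a : ℕ) : Function.update s.mem y a = St.mem { s with y := a } := by
  funext j; fin_cases j <;> rfl

theorem set_yy (s : St) (a : ℕ) : Function.update s.mem yy a = St.mem { s with yy := a } := by
  funext j; fin_cases j <;> rfl

theorem set_ll (s : St) (a : ℕ) : Function.update s.mem ll a = St.mem { s with ll := a } := by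
  funext j; fin_cases j <;> rfl

theorem set_z (s : St) (a : ℕ) : Function.update s.mem z a = St.mem { s with z := a } := by
  funext j; fin_cases j <;> rfl

theorem set_c (s : St) (a : ℕ) : Function.update s.mem c a = St.mem { s with c := a } := by
  funext j; fin_cases j <;> rfl

theorem set_t (s : St) (a : ℕ) : Function.update s.mem t a = St.mem { s with t := a } := by
  funext j; fin_cases j <;> rfl

theorem set_n (s : St) (a : ℕ) : Function.update s.mem n a = St.mem { s with n := a } := by
  funext j; fin_cases j <;> rfl

theorem set_num (s : St) (a : ℕ) : Function.update s.mem num a = St.mem { s with num := a } := by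
  funext j; fin_cases j <;> rfl

theorem set_den (s : St) (a : ℕ) : Function.update s.mem den a = St.mem { s with den := a } := by
  funext j; fin_cases j <;> rfl

theorem set_nx (s : St) (a : ℕ) : Function.update s.mem nx a = St.mem { s with nx := a } := by
  funext j; fin_cases j <;> rfl

theorem set_dx (s : St) (a : ℕ) : Function.update s.mem dx a = St.mem { s with dx := a } := by
  funext j; fin_cases j <;> rfl

theorem set_rk (s : St) (a : ℕ) : Function.update s.mem rk a = St.mem { s with rk := a } := by
  funext j; fin_cases j <;> rfl

theorem set_S (s : St) (a : ℕ) : Function.update s.mem S a = St.mem { s with S := a } := by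
  funext j; fin_cases j <;> rfl

theorem set_Z (s : St) (a : ℕ) : Function.update s.mem Z a = St.mem { s with Z := a } := by
  funext j; fin_cases j <;> rfl

theorem set_pw (s : St) (a : ℕ) : Function.update s.mem pw a = St.mem { s with pw := a } := by
  funext j; fin_cases j <;> rfl

theorem set_f (s : St) (a : ℕ) : Function.update s.mem f a = St.mem { s with f := a } := by
  funext j; fin_cases j <;> rfl

theorem set_go (s : St) (a : ℕ) : Function.update s.mem go a = St.mem { s with go := a } := by
  funext j; fin_cases j <;> rfl

end Reg

namespace Var

abbrev sg : Expr 25 := .reg Reg.sg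
abbrev r : Expr 25 := .reg Reg.r
abbrev sk : Expr 25 := .reg Reg.sk
abbrev L : Expr 25 := .reg Reg.L
abbrev G : Expr 25 := .reg Reg.G
abbrev B : Expr 25 := .reg Reg.B
abbrev x : Expr 25 := .reg Reg.x
abbrev ln : Expr 25 := .reg Reg.ln
abbrev y : Expr 25 := .reg Reg.y
abbrev yy : Expr 25 := .reg Reg.yy
abbrev ll : Expr 25 := .reg Reg.ll
abbrev z : Expr 25 := .reg Reg.z
abbrev c : Expr 25 := .reg Reg.c
abbrev t : Expr 25 := .reg Reg.t
abbrev n : Expr 25 := .reg Reg.n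
abbrev num : Expr 25 := .reg Reg.num
abbrev den : Expr 25 := .reg Reg.den
abbrev nx : Expr 25 := .reg Reg.nx
abbrev dx : Expr 25 := .reg Reg.dx
abbrev rk : Expr 25 := .reg Reg.rk
abbrev S : Expr 25 := .reg Reg.S
abbrev Z : Expr 25 := .reg Reg.Z
abbrev pw : Expr 25 := .reg Reg.pw
abbrev f : Expr 25 := .reg Reg.f
abbrev go : Expr 25 := .reg Reg.go

end Var

theorem St.mem_le {s : St} {N : ℕ} (h : ∀ a ∈ [s.sg, s.r, s.sk, s.L, s.G, s.B, s.x, s.ln, s.y, s.yy, s.ll, s.z, s.c, s.t, s.n, s.num, s.den, s.nx, s.dx, s.rk, s.S, s.Z, s.pw, s.f, s.go], a ≤ N) :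
    ∀ j, s.mem j ≤ N := by
  intro j
  unfold St.mem
  rw [List.getD_eq_getElem _ _ (by simp)]
  exact h _ (List.getElem_mem _)

/-! ### Program notation and derived execution rules -/

instance {m : ℕ} : Add (Expr m) := ⟨.add⟩
instance {m : ℕ} : Sub (Expr m) := ⟨.sub⟩
instance {m : ℕ} : Mul (Expr m) := ⟨.mul⟩
instance {m : ℕ} : Div (Expr m) := ⟨.div⟩
instance {m : ℕ} : Mod (Expr m) := ⟨.mod⟩
instance {m : ℕ} (c : ℕ) : OfNat (Expr m) c := ⟨.const c⟩

infixr:30 " ;; " => Prog.seq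
infix:45 " ≔ " => Prog.assign

/-- The value `a` is named separately from the expression so that the new state can be stated in
mathematical terms and the evaluation proved on the side. -/
theorem Run.asg {N : ℕ} {x : Fin 25} {e : Expr 25} {s s' : St} {i : List ℕ} (a : ℕ)
    (he : e.eval s.mem = a) (hs : Function.update s.mem x a = s'.mem) (ha : a ≤ N) :
    Run N (x ≔ e) s.mem i s'.mem i [] := by
  subst he
  rw [← hs]
  exact .assign x e _ i ha

theorem Run.read_nil {N : ℕ} {x : Fin 25} {s s' : St}
    (hs : Function.update s.mem x 0 = s'.mem) : Run N (.read x) s.mem [] s'.mem [] [] := by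
  rw [← hs]
  exact .read_end x _

theorem Run.read_head {N : ℕ} {x : Fin 25} {s s' : St} (a : ℕ) {i : List ℕ}
    (hs : Function.update s.mem x (a + 1) = s'.mem) (ha : a + 1 ≤ N) :
    Run N (.read x) s.mem (a :: i) s'.mem i [] := by
  rw [← hs]
  exact .read_cons x _ a i ha

/-- For loops whose body leaves unspecified values in scratch registers: the invariant is a
predicate that quantifies them away. -/
theorem Run.loop_inv {N : ℕ} {e : Expr 25} {p : Prog 25} {i : List ℕ} (I : ℕ → St → Prop) (n : ℕ)
    (h : ∀ j < n, ∀ s, I j s → e.eval s.mem ≠ 0 ∧ ∃ s', I (j + 1) s' ∧ Run N p s.mem i s'.mem i [])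
    (hend : ∀ s, I n s → e.eval s.mem = 0) (s : St) (hs : I 0 s) :
    ∃ s', I n s' ∧ Run N (.loop e p) s.mem i s'.mem i [] := by
  induction n generalizing s I with
  | zero => exact ⟨s, hs, .loop_false (hend s hs)⟩
  | succ n ih =>
    obtain ⟨hc, s', hs', hr⟩ := h 0 n.succ_pos s hs
    obtain ⟨s'', hs'', hr'⟩ := ih (fun j => I (j + 1)) (fun j hj => h (j + 1) (by omega)) hend s' hs'
    exact ⟨s'', hs'', .loop_true (o := []) (o' := []) hc hr hr'⟩

open Finset

/-! ### The adaptive probability of a block and its rank -/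

/-- In the number `y` in base `σ`, the number of earlier windows among `c` that agree with the last
one (`K` is `σ ^ k`). -/
def windowCount (σ K y c : ℕ) : ℕ :=
  ∑ j ∈ range c, if y / σ ^ (j + 1) % (K * σ) = y % (K * σ) then 1 else 0

/-- The number of earlier windows among `c` whose context agrees with that of the last window. -/
def contextCount (σ K y c : ℕ) : ℕ :=
  ∑ j ∈ range c, if y / σ ^ (j + 1) / σ % K = y / σ % K then 1 else 0

/-- The first `j` factors of the numerator of the probability of `y`. -/
def probNumAux (σ r K m y j : ℕ) : ℕ :=
  ∏ i ∈ range j, (σ * windowCount σ K (y / σ ^ i) (m - i - 1) + r)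

/-- The first `j` factors of the denominator of the probability of `y`. -/
def probDenAux (σ r K m y j : ℕ) : ℕ :=
  ∏ i ∈ range j, (σ * (contextCount σ K (y / σ ^ i) (m - i - 1) + r))

/-- The numerator of the probability of the last `m` digits of `y`. -/
def probNum (σ r K m y : ℕ) : ℕ := probNumAux σ r K m y m

/-- The denominator of the probability of the last `m` digits of `y`. -/
def probDen (σ r K m y : ℕ) : ℕ := probDenAux σ r K m y m

/-- The number of `y < S` that are more probable than `x`, or as probable and smaller. -/
def rank (σ r K m S x : ℕ) : ℕ :=
  ∑ y ∈ range S, if probNum σ r K m x * probDen σ r K m y <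
    probNum σ r K m y * probDen σ r K m x + (if y < x then 1 else 0) then 1 else 0

theorem windowCount_le (σ K y c : ℕ) : windowCount σ K y c ≤ c := by
  unfold windowCount
  calc _ ≤ ∑ _j ∈ range c, 1 := sum_le_sum (fun j _ => by split_ifs <;> simp)
    _ = c := by simp

theorem contextCount_le (σ K y c : ℕ) : contextCount σ K y c ≤ c := by
  unfold contextCount
  calc _ ≤ ∑ _j ∈ range c, 1 := sum_le_sum (fun j _ => by split_ifs <;> simp)
    _ = c := by simp

theorem rank_le (σ r K m S x : ℕ) : rank σ r K m S x ≤ S := by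
  unfold rank
  calc _ ≤ ∑ _y ∈ range S, 1 := sum_le_sum (fun j _ => by split_ifs <;> simp)
    _ = S := by simp

/-- There are at most `m` factors, each at most `σ * (m + r)` because a count of earlier windows is
at most `m`. -/
theorem probNumAux_le {σ r K m y j : ℕ} (hσ : 1 ≤ σ) (hr : 1 ≤ r) (hj : j ≤ m) :
    probNumAux σ r K m y j ≤ (σ * (m + r)) ^ m := by
  calc probNumAux σ r K m y j ≤ (σ * (m + r)) ^ (range j).card := by
        refine prod_le_pow_card _ _ _ fun i _ => ?_
        have := windowCount_le σ K (y / σ ^ i) (m - i - 1)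
        nlinarith [Nat.sub_le (m - i) 1, Nat.sub_le m i]
    _ ≤ _ := by
        rw [card_range]
        exact Nat.pow_le_pow_right (by nlinarith) hj

theorem probDenAux_le {σ r K m y j : ℕ} (hσ : 1 ≤ σ) (hr : 1 ≤ r) (hj : j ≤ m) :
    probDenAux σ r K m y j ≤ (σ * (m + r)) ^ m := by
  calc probDenAux σ r K m y j ≤ (σ * (m + r)) ^ (range j).card := by
        refine prod_le_pow_card _ _ _ fun i _ => ?_
        have := contextCount_le σ K (y / σ ^ i) (m - i - 1)
        exact Nat.mul_le_mul_left _ (by omega)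
    _ ≤ _ := by
        rw [card_range]
        exact Nat.pow_le_pow_right (by nlinarith) hj

/-- With truncated subtraction, the two one-sided differences vanish together only at equality. -/
theorem one_sub_dist (a b : ℕ) : 1 - ((a - b) + (b - a)) = if a = b then 1 else 0 := by
  split_ifs <;> omega

/-! ### Programs for them -/

/-- The indicator of equality. -/
def Expr.eqTest {m : ℕ} (e f : Expr m) : Expr m := 1 - ((e - f) + (f - e))

open Var in
/-- One step of counting windows. -/
def countStep : Prog 25 :=
  Reg.z ≔ z / sg ;;
  Reg.t ≔ t + Expr.eqTest (z % (sk * sg)) (yy % (sk * sg)) ;;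
  Reg.n ≔ n + Expr.eqTest (z / sg % sk) (yy / sg % sk) ;;
  Reg.c ≔ c - 1

open Var in
/-- Counting the windows of `yy` in `ll` digits that agree with the last one. -/
def countProg (k : ℕ) : Prog 25 :=
  Reg.z ≔ yy ;; Reg.c ≔ ll - .const k - 1 ;; Reg.t ≔ 0 ;; Reg.n ≔ 0 ;; .loop c countStep

theorem run_countProg {N k : ℕ} (s : St) (i : List ℕ) (hy : s.yy ≤ N) (hl : s.ll ≤ N) :
    Run N (countProg k) s.mem i
      (St.mem { s with
        z := s.yy / s.sg ^ (s.ll - k - 1), c := 0,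
        t := windowCount s.sg s.sk s.yy (s.ll - k - 1),
        n := contextCount s.sg s.sk s.yy (s.ll - k - 1) }) i [] := by
  -- A string of `ll` digits has `ll - k` windows of length `k + 1`; one of them is the last window
  -- itself.
  set M := s.ll - k - 1 with hM
  have hMN : M ≤ N := by omega
  -- A digit is dropped from `z` before each comparison, hence the exponents `j + 1` in the counts.
  let st : ℕ → St := fun j => { s with
    z := s.yy / s.sg ^ j, c := M - j,
    t := windowCount s.sg s.sk s.yy j, n := contextCount s.sg s.sk s.yy j }
  have hloop : Run N (.loop Var.c countStep) (st 0).mem i (st M).mem i [] := by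
    refine Run.loop_iterate (fun j => (st j).mem) i M (fun j hj => ⟨?_, ?_⟩) ?_
    · change M - j ≠ 0
      omega
    · refine Run.seq_nil (Run.asg (s.yy / s.sg ^ (j + 1)) ?_ (Reg.set_z _ _) ?_) <|
        Run.seq_nil (Run.asg (windowCount s.sg s.sk s.yy (j + 1)) ?_ (Reg.set_t _ _) ?_) <|
        Run.seq_nil (Run.asg (contextCount s.sg s.sk s.yy (j + 1)) ?_ (Reg.set_n _ _) ?_) <|
        Run.asg (M - (j + 1)) rfl (Reg.set_c _ _) (by omega)
      · change s.yy / s.sg ^ j / s.sg = _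
        rw [Nat.div_div_eq_div_mul, pow_succ]
      · exact (Nat.div_le_self _ _).trans hy
      · change windowCount s.sg s.sk s.yy j +
          (1 - ((s.yy / s.sg ^ (j + 1) % (s.sk * s.sg) - s.yy % (s.sk * s.sg)) +
            (s.yy % (s.sk * s.sg) - s.yy / s.sg ^ (j + 1) % (s.sk * s.sg)))) = _
        rw [one_sub_dist, windowCount, windowCount, sum_range_succ]
      · exact (windowCount_le _ _ _ _).trans (by omega)
      · change contextCount s.sg s.sk s.yy j +
          (1 - ((s.yy / s.sg ^ (j + 1) / s.sg % s.sk - s.yy / s.sg % s.sk) +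
            (s.yy / s.sg % s.sk - s.yy / s.sg ^ (j + 1) / s.sg % s.sk))) = _
        rw [one_sub_dist, contextCount, contextCount, sum_range_succ]
      · exact (contextCount_le _ _ _ _).trans (by omega)
    · change M - M = 0
      omega
  have h0 : (st 0).mem =
      St.mem { { { { s with z := s.yy } with c := M } with t := 0 } with n := 0 } := by
    simp [st, windowCount, contextCount]
  have hM' : st M = { s with
        z := s.yy / s.sg ^ M, c := 0,
        t := windowCount s.sg s.sk s.yy M, n := contextCount s.sg s.sk s.yy M } := by
    simp [st]
  rw [h0, hM'] at hloop
  exact Run.seq_nil (Run.asg s.yy rfl (Reg.set_z _ _) hy) <|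
    Run.seq_nil (Run.asg M rfl (Reg.set_c _ _) hMN) <|
    Run.seq_nil (Run.asg 0 rfl (Reg.set_t _ _) (Nat.zero_le _)) <|
    Run.seq_nil (Run.asg 0 rfl (Reg.set_n _ _) (Nat.zero_le _)) hloop

open Var in
/-- The probability of the number `y` with `ln` digits, as a fraction `num / den`. -/
def probProg (k : ℕ) : Prog 25 :=
  Reg.num ≔ 1 ;; Reg.den ≔ 1 ;; Reg.yy ≔ y ;; Reg.ll ≔ ln ;;
  .loop (ll - .const k)
    (countProg k ;; Reg.num ≔ num * (sg * t + r) ;; Reg.den ≔ den * (sg * (n + r)) ;;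
      Reg.yy ≔ yy / sg ;; Reg.ll ≔ ll - 1)

/-- The factors are collected from the last character backwards: stripping a digit of `yy` exposes
the previous prefix. The existential variables are scratch values. -/
theorem run_probProg {N k : ℕ} (s : St) (i : List ℕ) (hy : s.y ≤ N) (hl : s.ln ≤ N)
    (hσ : 1 ≤ s.sg) (hr : 1 ≤ s.r) (hN : (s.sg * (s.ln + s.r)) ^ s.ln ≤ N) :
    ∃ a b c d e f, Run N (probProg k) s.mem i
      (St.mem { s with
        num := probNum s.sg s.r s.sk (s.ln - k) s.y,
        den := probDen s.sg s.r s.sk (s.ln - k) s.y,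
        yy := a, ll := b, z := c, c := d, t := e, n := f }) i [] := by
  have h1N : 1 ≤ N := le_trans (Nat.one_le_pow _ _ (by nlinarith)) hN
  set m := s.ln - k with hm
  have hmN : (s.sg * (m + s.r)) ^ m ≤ N := by
    refine le_trans ?_ hN
    refine (Nat.pow_le_pow_left (Nat.mul_le_mul_left _ (by omega : m + s.r ≤ s.ln + s.r)) _).trans ?_
    exact Nat.pow_le_pow_right (by nlinarith) (by omega)
  let I : ℕ → St → Prop := fun j s' => ∃ c d e f, s' = { s with
        num := probNumAux s.sg s.r s.sk m s.y j,
        den := probDenAux s.sg s.r s.sk m s.y j,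
        yy := s.y / s.sg ^ j, ll := s.ln - j, z := c, c := d, t := e, n := f }
  have hyj : ∀ j, s.y / s.sg ^ j ≤ N := fun j => (Nat.div_le_self _ _).trans hy
  have key := Run.loop_inv (N := N) (e := Var.ll - .const k)
    (p := countProg k ;; Reg.num ≔ Var.num * (Var.sg * Var.t + Var.r) ;;
      Reg.den ≔ Var.den * (Var.sg * (Var.n + Var.r)) ;;
      Reg.yy ≔ Var.yy / Var.sg ;; Reg.ll ≔ Var.ll - 1) (i := i) I m ?_ ?_
    { s with num := 1, den := 1, yy := s.y, ll := s.ln }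
    ⟨s.z, s.c, s.t, s.n, by simp [probNumAux, probDenAux]⟩
  · obtain ⟨s', ⟨c, d, e, f, rfl⟩, hr'⟩ := key
    refine ⟨s.y / s.sg ^ m, s.ln - m, c, d, e, f, ?_⟩
    exact Run.seq_nil (Run.asg 1 rfl (Reg.set_num _ _) h1N) <|
      Run.seq_nil (Run.asg 1 rfl (Reg.set_den _ _) h1N) <|
      Run.seq_nil (Run.asg s.y rfl (Reg.set_yy _ _) hy) <|
      Run.seq_nil (Run.asg s.ln rfl (Reg.set_ll _ _) hl) hr'
  · rintro j hj _ ⟨c, d, e, f, rfl⟩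
    refine ⟨?_, _, ⟨_, _, _, _, rfl⟩, Run.seq_nil (run_countProg _ i (hyj j) ?_) <|
      Run.seq_nil (Run.asg (probNumAux s.sg s.r s.sk m s.y (j + 1)) ?_ (Reg.set_num _ _) ?_) <|
      Run.seq_nil (Run.asg (probDenAux s.sg s.r s.sk m s.y (j + 1)) ?_ (Reg.set_den _ _) ?_) <|
      Run.seq_nil (Run.asg (s.y / s.sg ^ (j + 1)) ?_ (Reg.set_yy _ _) (hyj _)) <|
      Run.asg (s.ln - (j + 1)) rfl (Reg.set_ll _ _) (by omega)⟩
    · change s.ln - j - k ≠ 0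
      omega
    · change s.ln - j ≤ N
      omega
    · change probNumAux s.sg s.r s.sk m s.y j * (s.sg *
        windowCount s.sg s.sk (s.y / s.sg ^ j) (s.ln - j - k - 1) + s.r) = _
      rw [probNumAux, probNumAux, prod_range_succ, show s.ln - j - k = m - j by omega]
    · exact (probNumAux_le hσ hr hj).trans hmN
    · change probDenAux s.sg s.r s.sk m s.y j * (s.sg *
        (contextCount s.sg s.sk (s.y / s.sg ^ j) (s.ln - j - k - 1) + s.r)) = _
      rw [probDenAux, probDenAux, prod_range_succ, show s.ln - j - k = m - j by omega]
    · exact (probDenAux_le hσ hr hj).trans hmN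
    · change s.y / s.sg ^ j / s.sg = _
      rw [Nat.div_div_eq_div_mul, pow_succ]
  · rintro _ ⟨c, d, e, f, rfl⟩
    change s.ln - m - k = 0
    omega

/-- Comparisons are needed as arithmetic expressions, since the rank accumulates them by addition.
-/
theorem one_sub_succ_sub (y x : ℕ) : 1 - (y + 1 - x) = if y < x then 1 else 0 := by
  split_ifs <;> omega

theorem one_sub_one_sub_sub (a b : ℕ) : 1 - (1 - (a - b)) = if b < a then 1 else 0 := by
  split_ifs <;> omega

open Var in
/-- The number `S` of blocks of length `ln`. -/
def powProg : Prog 25 :=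
  Reg.S ≔ 1 ;; Reg.c ≔ ln ;; .loop c (Reg.S ≔ S * sg ;; Reg.c ≔ c - 1)

theorem run_powProg {N : ℕ} (s : St) (i : List ℕ) (hl : s.ln ≤ N) (hσ : 1 ≤ s.sg)
    (hN : s.sg ^ s.ln ≤ N) :
    Run N powProg s.mem i (St.mem { s with S := s.sg ^ s.ln, c := 0 }) i [] := by
  have h1N : 1 ≤ N := le_trans (Nat.one_le_pow _ _ hσ) hN
  let st : ℕ → St := fun j => { s with S := s.sg ^ j, c := s.ln - j }
  have hloop : Run N (.loop Var.c (Reg.S ≔ Var.S * Var.sg ;; Reg.c ≔ Var.c - 1))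
      (st 0).mem i (st s.ln).mem i [] := by
    refine Run.loop_iterate (fun j => (st j).mem) i s.ln (fun j hj => ⟨?_, ?_⟩) ?_
    · change s.ln - j ≠ 0
      omega
    · refine Run.seq_nil (Run.asg (s.sg ^ (j + 1)) rfl (Reg.set_S _ _) ?_) <|
        Run.asg (s.ln - (j + 1)) rfl (Reg.set_c _ _) (by omega)
      exact (Nat.pow_le_pow_right hσ hj).trans hN
    · change s.ln - s.ln = 0
      omega
  have h0 : (st 0).mem = St.mem { { s with S := 1 } with c := s.ln } := by simp [st]
  have h1 : st s.ln = { s with S := s.sg ^ s.ln, c := 0 } := by simp [st]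
  rw [h0, h1] at hloop
  exact Run.seq_nil (Run.asg 1 rfl (Reg.set_S _ _) h1N) <|
    Run.seq_nil (Run.asg s.ln rfl (Reg.set_c _ _) hl) hloop

open Var in
/-- The rank of the block `x` among the blocks of length `ln`. -/
def rankProg (k : ℕ) : Prog 25 :=
  Reg.y ≔ x ;; probProg k ;; Reg.nx ≔ num ;; Reg.dx ≔ den ;; powProg ;; Reg.rk ≔ 0 ;; Reg.y ≔ 0 ;;
  .loop (S - y) (probProg k ;;
    Reg.rk ≔ rk + (1 - (1 - (num * dx + (1 - (y + 1 - x)) - nx * den))) ;;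
    Reg.y ≔ y + 1)

theorem run_rankProg {N k : ℕ} (s : St) (i : List ℕ) (hx : s.x ≤ N) (hl : s.ln ≤ N)
    (hσ : 1 ≤ s.sg) (hr : 1 ≤ s.r) (hN : (s.sg * (s.ln + s.r)) ^ s.ln ≤ N) :
    ∃ a b c d e f g h p q l, Run N (rankProg k) s.mem i
      (St.mem { s with
        rk := rank s.sg s.r s.sk (s.ln - k) (s.sg ^ s.ln) s.x, S := s.sg ^ s.ln,
        yy := a, ll := b, z := c, c := d, t := e, n := f, num := g, den := h, nx := p, dx := q,
        y := l }) i [] := by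
  have hSN : s.sg ^ s.ln ≤ N :=
    (Nat.pow_le_pow_left (Nat.le_mul_of_pos_right _ (by omega)) _).trans hN
  set m := s.ln - k with hm
  set nx := probNum s.sg s.r s.sk m s.x with hnx
  set dx := probDen s.sg s.r s.sk m s.x with hdx
  have hmN : (s.sg * (m + s.r)) ^ m ≤ N := by
    refine le_trans ?_ hN
    refine (Nat.pow_le_pow_left (Nat.mul_le_mul_left _ (by omega : m + s.r ≤ s.ln + s.r)) _).trans ?_
    exact Nat.pow_le_pow_right (by nlinarith) (by omega)
  have hnxN : nx ≤ N := (probNumAux_le hσ hr le_rfl).trans hmN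
  have hdxN : dx ≤ N := (probDenAux_le hσ hr le_rfl).trans hmN
  obtain ⟨a, b, c, d, e, f, h1⟩ := run_probProg (k := k) { s with y := s.x } i hx hl hσ hr hN
  -- The fraction of `x` stays in `nx` and `dx` while `y` runs through all blocks of the same
  -- length.
  let I : ℕ → St → Prop := fun j s' => ∃ a b c d e f g h, s' = { s with
        rk := rank s.sg s.r s.sk m j s.x, S := s.sg ^ s.ln,
        yy := a, ll := b, z := c, c := d, t := e, n := f, num := g, den := h, nx := nx, dx := dx,
        y := j }
  have key := Run.loop_inv (N := N) (e := Var.S - Var.y)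
    (p := probProg k ;;
      Reg.rk ≔ Var.rk + (1 - (1 - (Var.num * Var.dx + (1 - (Var.y + 1 - Var.x)) -
        Var.nx * Var.den))) ;;
      Reg.y ≔ Var.y + 1) (i := i) I (s.sg ^ s.ln) ?_ ?_
    { s with
      rk := 0, S := s.sg ^ s.ln, yy := a, ll := b, z := c, c := 0, t := e, n := f,
      num := nx, den := dx, nx := nx, dx := dx, y := 0 }
    ⟨a, b, c, 0, e, f, nx, dx, by simp [rank]⟩
  · obtain ⟨s', ⟨a', b', c', d', e', f', g', h', rfl⟩, hr'⟩ := key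
    refine ⟨a', b', c', d', e', f', g', h', nx, dx, s.sg ^ s.ln, ?_⟩
    exact Run.seq_nil (Run.asg s.x rfl (Reg.set_y _ _) hx) <|
      Run.seq_nil h1 <|
      Run.seq_nil (Run.asg nx rfl (Reg.set_nx _ _) hnxN) <|
      Run.seq_nil (Run.asg dx rfl (Reg.set_dx _ _) hdxN) <|
      Run.seq_nil (run_powProg _ i hl hσ hSN) <|
      Run.seq_nil (Run.asg 0 rfl (Reg.set_rk _ _) (Nat.zero_le _)) <|
      Run.seq_nil (Run.asg 0 rfl (Reg.set_y _ _) (Nat.zero_le _)) hr'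
  · rintro j hj _ ⟨a, b, c, d, e, f, g, h, rfl⟩
    obtain ⟨a', b', c', d', e', f', h2⟩ := run_probProg (k := k) { s with
        rk := rank s.sg s.r s.sk m j s.x, S := s.sg ^ s.ln,
        yy := a, ll := b, z := c, c := d, t := e, n := f, num := g, den := h, nx := nx, dx := dx,
        y := j } i (by change j ≤ N; omega) hl hσ hr hN
    refine ⟨?_, _, ⟨_, _, _, _, _, _, _, _, rfl⟩, Run.seq_nil h2 <|
      Run.seq_nil (Run.asg (rank s.sg s.r s.sk m (j + 1) s.x) ?_ (Reg.set_rk _ _) ?_) <|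
      Run.asg (j + 1) rfl (Reg.set_y _ _) (by omega)⟩
    · change s.sg ^ s.ln - j ≠ 0
      omega
    -- The cross products may exceed `N`, but only the resulting indicator is stored; `Run` bounds
    -- stored values and `Run.exec` accounts for the intermediate ones.
    · change rank s.sg s.r s.sk m j s.x + (1 - (1 - (probNum s.sg s.r s.sk m j * dx +
        (1 - (j + 1 - s.x)) - nx * probDen s.sg s.r s.sk m j))) = _
      rw [one_sub_one_sub_sub, one_sub_succ_sub, rank, rank, sum_range_succ]
    · exact (rank_le _ _ _ _ _ _).trans (by omega)
  · rintro _ ⟨a, b, c, d, e, f, g, h, rfl⟩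
    change s.sg ^ s.ln - s.sg ^ s.ln = 0
    omega

/-! ### Numbers as strings of digits -/

/-- The number with the given digits in base `β`, the most significant digit first. -/
def numVal (β : ℕ) (l : List ℕ) : ℕ := l.foldl (fun x a => x * β + a) 0

/-- The last `n` digits of `z` in base `β`, the most significant digit first. -/
def digitsBE (β : ℕ) : ℕ → ℕ → List ℕ
  | 0, _ => []
  | n + 1, z => z / β ^ n % β :: digitsBE β n z

/-- The self-delimiting code of `z` in groups of `g` bits. -/
def codeword (g z : ℕ) : List Bool :=
  List.replicate (Nat.clog (2 ^ g) (z + 1)) true ++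
    false :: (digitsBE 2 (Nat.clog (2 ^ g) (z + 1) * g) z).map (· == 1)

theorem length_digitsBE (β n z : ℕ) : (digitsBE β n z).length = n := by
  induction n with
  | zero => rfl
  | succ n ih => simp [digitsBE, ih]

theorem bitStream_append (c d : List Bool) : bitStream (c ++ d) = bitStream c ++ bitStream d := by
  simp [bitStream]

theorem bitStream_codeword (g z : ℕ) : bitStream (codeword g z) =
    List.replicate (Nat.clog (2 ^ g) (z + 1)) 1 ++
      0 :: digitsBE 2 (Nat.clog (2 ^ g) (z + 1) * g) z := by
  have h : ∀ n, ((digitsBE 2 n z).map (· == 1)).map Bool.toNat = digitsBE 2 n z := by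
    intro n
    induction n with
    | zero => rfl
    | succ n ih =>
      simp only [digitsBE, List.map_cons, ih]
      congr 1
      rcases Nat.mod_two_eq_zero_or_one (z / 2 ^ n) with h | h <;> simp [h]
  simp only [codeword, bitStream, List.map_append, List.map_replicate, List.map_cons, h]
  rfl

theorem numVal_append_singleton (β : ℕ) (l : List ℕ) (a : ℕ) :
    numVal β (l ++ [a]) = numVal β l * β + a := by
  simp [numVal]

theorem numVal_append (β : ℕ) (l l' : List ℕ) :
    numVal β (l ++ l') = numVal β l * β ^ l'.length + numVal β l' := by
  induction l' using List.reverseRecOn with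
  | nil => simp [numVal]
  | append_singleton l' a ih =>
    rw [← List.append_assoc, numVal_append_singleton, ih, numVal_append_singleton]
    simp only [List.length_append, List.length_singleton, pow_succ]
    ring

theorem numVal_lt {β : ℕ} {l : List ℕ} (h : ∀ a ∈ l, a < β) : numVal β l < β ^ l.length := by
  induction l using List.reverseRecOn with
  | nil => simp [numVal]
  | append_singleton l a ih =>
    rw [numVal_append_singleton]
    have h1 := ih fun b hb => h b (by simp [hb])
    have h2 := h a (by simp)
    simp only [List.length_append, List.length_singleton, pow_succ]
    nlinarith

/-- The prefix `l` is there for the induction: the leading digit of `l'` moves into it, and the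
lower digits do not see it. -/
theorem digitsBE_numVal_append {β : ℕ} (l l' : List ℕ) (h : ∀ a ∈ l', a < β) :
    digitsBE β l'.length (numVal β (l ++ l')) = l' := by
  induction l' generalizing l with
  | nil => rfl
  | cons a l' ih =>
    have hl' : ∀ b ∈ l', b < β := fun b hb => h b (by simp [hb])
    have ha := h a (by simp)
    have := ih (l ++ [a]) hl'
    rw [List.append_assoc, List.singleton_append] at this
    simp only [List.length_cons, digitsBE, this]
    congr 1
    have hp : 0 < β ^ l'.length := Nat.pow_pos (by omega)
    rw [show l ++ a :: l' = (l ++ [a]) ++ l' by simp, numVal_append, Nat.add_comm,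
      Nat.add_mul_div_right _ _ hp, Nat.div_eq_of_lt (numVal_lt hl'), numVal_append_singleton]
    simp [Nat.add_mod, Nat.mod_eq_of_lt ha]

theorem digitsBE_numVal {β : ℕ} (l : List ℕ) (h : ∀ a ∈ l, a < β) :
    digitsBE β l.length (numVal β l) = l := by
  simpa using digitsBE_numVal_append [] l h

/-! ### Programs for input and output -/

open Var in
/-- Reading up to `B` characters of a block into `x`. -/
def readBlock : Prog 25 :=
  .loop (f * (B - ln)) (.read Reg.f ;;
    .ite f (Reg.x ≔ x * sg + (f - 1) ;; Reg.ln ≔ ln + 1) .skip)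

/-- The product in the loop test is a conjunction: the input has not ended and the block is not
full. If the input ends exactly with the block, the end is not noticed yet, so `f` stays nonzero. -/
theorem run_readBlock {N : ℕ} (inp : List ℕ) (s : St) (hf : s.f ≠ 0) (hl : s.ln ≤ s.B)
    (hB : s.B ≤ N) (hx : s.x < s.sg ^ s.ln) (hinp : ∀ a ∈ inp, a < s.sg) (hσ : s.sg ≤ N)
    (hN : s.sg ^ s.B ≤ N) :
    ∃ f', (f' ≠ 0 ↔ s.B - s.ln ≤ inp.length) ∧ Run N readBlock s.mem inp
      (St.mem { s with
        x := (inp.take (s.B - s.ln)).foldl (fun x a => x * s.sg + a) s.x,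
        ln := s.ln + (inp.take (s.B - s.ln)).length, f := f' })
      (inp.drop (s.B - s.ln)) [] := by
  induction inp generalizing s with
  | nil =>
    by_cases h : s.B - s.ln = 0
    · refine ⟨s.f, by simp [h, hf], ?_⟩
      simp only [List.take_nil, List.foldl_nil, List.length_nil, add_zero, List.drop_nil]
      refine .loop_false ?_
      change s.f * (s.B - s.ln) = 0
      rw [h, mul_zero]
    · refine ⟨0, by simp; omega, ?_⟩
      simp only [List.take_nil, List.foldl_nil, List.length_nil, add_zero, List.drop_nil]
      refine .loop_true (o := []) (o' := []) (v' := St.mem { s with f := 0 }) (i' := []) ?_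
        (Run.seq_nil ?_ (.ite_false rfl (.skip _ _))) (.loop_false ?_)
      · change s.f * (s.B - s.ln) ≠ 0
        exact mul_ne_zero hf h
      · exact .read_nil (Reg.set_f _ _)
      · change 0 * (s.B - s.ln) = 0
        rw [zero_mul]
  | cons a inp ih =>
    by_cases h : s.B - s.ln = 0
    · refine ⟨s.f, by simp [h, hf], ?_⟩
      simp only [h, List.take_zero, List.foldl_nil, List.length_nil, add_zero, List.drop_zero]
      refine .loop_false ?_
      change s.f * (s.B - s.ln) = 0
      rw [h, mul_zero]
    · have ha := hinp a (by simp)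
      have hx' : s.x * s.sg + a < s.sg ^ (s.ln + 1) := by
        rw [pow_succ]
        nlinarith
      obtain ⟨f', hf', hr⟩ := ih { s with x := s.x * s.sg + a, ln := s.ln + 1, f := a + 1 }
        (by simp) (by change s.ln + 1 ≤ s.B; omega) hB hx' (fun b hb => hinp b (by simp [hb])) hσ hN
      dsimp only at hf' hr
      obtain ⟨d, hd⟩ := Nat.exists_eq_succ_of_ne_zero h
      have hd' : s.B - (s.ln + 1) = d := by omega
      rw [hd'] at hf' hr
      refine ⟨f', by rw [hf', hd]; simp, ?_⟩
      rw [hd]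
      simp only [Nat.succ_eq_add_one, List.take_succ_cons, List.foldl_cons, List.length_cons, List.drop_succ_cons]
      rw [show s.ln + ((List.take d inp).length + 1) = s.ln + 1 + (List.take d inp).length by omega]
      refine .loop_true (o := []) (o' := []) ?_
        (Run.seq_nil (v' := St.mem { s with f := a + 1 }) (i' := inp) ?_ (.ite_true ?_
          (Run.seq_nil (Run.asg (s.x * s.sg + a) ?_ (Reg.set_x _ _) ?_)
            (Run.asg (s.ln + 1) rfl (Reg.set_ln _ _) (by omega))))) hr
      · change s.f * (s.B - s.ln) ≠ 0
        exact mul_ne_zero hf h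
      · exact .read_head a (Reg.set_f _ _) (by omega)
      · change a + 1 ≠ 0
        omega
      · change s.x * s.sg + (a + 1 - 1) = _
        rw [Nat.add_sub_cancel]
      · refine hx'.le.trans ((Nat.pow_le_pow_right (by omega) ?_).trans hN)
        omega

open Var in
/-- Writing the digits of `Z` in base `L` below the power `pw`. -/
def writeDigits : Prog 25 :=
  .loop (pw - 1) (Reg.pw ≔ pw / L ;; .write (Z / pw % L))

/-- The power `pw` doubles as the loop counter; it reaches 1 when all digits are out. -/
theorem run_writeDigits {N : ℕ} (n : ℕ) (s : St) (i : List ℕ) (hL : 2 ≤ s.L) (hpw : s.pw = s.L ^ n)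
    (hN : s.pw ≤ N) :
    Run N writeDigits s.mem i (St.mem { s with pw := 1 }) i (digitsBE s.L n s.Z) := by
  induction n generalizing s with
  | zero =>
    rw [pow_zero] at hpw
    have h1 : s = { s with pw := 1 } := by rw [← hpw]
    rw [← h1]
    refine .loop_false ?_
    change s.pw - 1 = 0
    omega
  | succ n ih =>
    have h1 : s.pw / s.L = s.L ^ n := by
      rw [hpw, pow_succ, Nat.mul_div_cancel _ (by omega)]
    have h2 : s.L ^ n ≤ N := by
      rw [← h1]
      exact (Nat.div_le_self _ _).trans hN
    have := ih { s with pw := s.L ^ n } hL rfl h2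
    refine .loop_true (o := [s.Z / s.L ^ n % s.L]) ?_
      (Run.seq_nil (Run.asg (s.L ^ n) h1 (Reg.set_pw _ _) h2) (.write _ _ _)) this
    change s.pw - 1 ≠ 0
    have := Nat.one_lt_pow (n := n + 1) (by omega) (show 1 < s.L by omega)
    omega

open Var in
/-- Writing the self-delimiting code of `Z`. -/
def writeCode : Prog 25 :=
  Reg.pw ≔ 1 ;; .loop (Z + 1 - pw) (.write 1 ;; Reg.pw ≔ pw * G) ;; .write 0 ;; Reg.L ≔ 2 ;;
  writeDigits

/-- The loop stops at the first power of `G` above `Z`, whose exponent is the ceiling logarithm.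
Each multiplication starts from a power at most `Z`, so `Z * G` bounds the register. -/
theorem run_writeUnary {N g : ℕ} (n j : ℕ) (s : St) (i : List ℕ) (hg : 0 < g) (hG : s.G = 2 ^ g)
    (hj : j + n = Nat.clog (2 ^ g) (s.Z + 1)) (hpw : s.pw = s.G ^ j) (hN : s.Z * s.G ≤ N) :
    Run N (.loop (Var.Z + 1 - Var.pw) (.write 1 ;; Reg.pw ≔ Var.pw * Var.G)) s.mem i
      (St.mem { s with pw := s.G ^ (j + n) }) i (List.replicate n 1) := by
  have hb : 1 < 2 ^ g := Nat.one_lt_two_pow hg.ne'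
  induction n generalizing j s with
  | zero =>
    rw [add_zero, ← hpw]
    refine .loop_false ?_
    change s.Z + 1 - s.pw = 0
    have := Nat.le_pow_clog hb (s.Z + 1)
    rw [← hj, add_zero, ← hG, ← hpw] at this
    omega
  | succ n ih =>
    have h1 : s.G ^ j < s.Z + 1 := by
      rw [hG]
      exact (Nat.lt_clog_iff_pow_lt hb).1 (by omega)
    have := ih (j + 1) { s with pw := s.G ^ (j + 1) } hG (by rw [← hj]; ring) rfl hN
    dsimp only at this
    rw [show j + 1 + n = j + (n + 1) by ring] at this
    refine .loop_true (o := [1]) ?_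
      (Run.seq_out_nil (.write _ _ _) (Run.asg (s.G ^ (j + 1)) ?_ (Reg.set_pw _ _) ?_)) this
    · change s.Z + 1 - s.pw ≠ 0
      omega
    · change s.pw * s.G = _
      rw [hpw, pow_succ]
    · rw [pow_succ]
      exact (Nat.mul_le_mul_right _ (by omega)).trans hN

/-- By minimality of the ceiling logarithm, one exponent less gives a power below `z + 1`. -/
theorem pow_clog_le {b z : ℕ} (hb : 1 < b) : b ^ Nat.clog b (z + 1) ≤ b * (z + 1) := by
  rcases Nat.eq_zero_or_pos (Nat.clog b (z + 1)) with h | h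
  · rw [h, pow_zero]
    nlinarith
  · obtain ⟨j, hj⟩ := Nat.exists_eq_succ_of_ne_zero h.ne'
    have : b ^ j < z + 1 := (Nat.lt_clog_iff_pow_lt hb).1 (by omega)
    rw [hj, pow_succ, mul_comm]
    exact Nat.mul_le_mul_left _ this.le

theorem run_writeCode {N g : ℕ} (s : St) (i : List ℕ) (hg : 0 < g) (hG : s.G = 2 ^ g)
    (hN : s.G * (s.Z + 1) ≤ N) :
    Run N writeCode s.mem i (St.mem { s with pw := 1, L := 2 }) i
      (bitStream (codeword g s.Z)) := by
  have hb : 1 < 2 ^ g := Nat.one_lt_two_pow hg.ne'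
  have hG1 : 2 ≤ s.G := by omega
  have h2N : 2 ≤ N := by nlinarith
  set j := Nat.clog (2 ^ g) (s.Z + 1) with hj
  have hpw : s.G ^ j ≤ N := by
    rw [hG]
    rw [hG] at hN
    exact (pow_clog_le hb).trans hN
  have h1 := run_writeUnary (N := N) j 0 { s with pw := 1 } i hg hG (by simp [hj]) (by simp)
    (by change s.Z * s.G ≤ N; nlinarith)
  have h2 := run_writeDigits (N := N) (j * g) { s with pw := s.G ^ (0 + j), L := 2 } i
    le_rfl (by change s.G ^ (0 + j) = 2 ^ (j * g); rw [hG, zero_add, ← pow_mul, mul_comm])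
    (by simpa using hpw)
  rw [bitStream_codeword]
  exact Run.seq_nil (Run.asg 1 rfl (Reg.set_pw _ _) (by omega)) <|
    Run.seq h1 <|
    Run.seq (o := [0]) (.write _ _ _) <|
    Run.seq_nil (Run.asg 2 rfl (Reg.set_L _ _) h2N) h2

open Var in
/-- Reading the unary part of a code; `pw` becomes the power of two above its bits. -/
def readUnary : Prog 25 :=
  .loop f (.read Reg.f ;; Reg.f ≔ f - 1 ;; .ite f (Reg.pw ≔ pw * G) .skip)

open Var in
/-- Reading as many bits as `pw` says. -/
def readDigits : Prog 25 :=
  .loop (pw - 1) (.read Reg.f ;; Reg.Z ≔ 2 * Z + (f - 1) ;; Reg.pw ≔ pw / 2)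

/-- Reading a self-delimiting code into `Z`. -/
def readCode : Prog 25 :=
  Reg.pw ≔ 1 ;; Reg.f ≔ 1 ;; readUnary ;; Reg.Z ≔ 0 ;; readDigits

theorem run_readUnary {N : ℕ} (n : ℕ) (s : St) (i : List ℕ) (hf : s.f = 1)
    (h2 : 2 ≤ N) (hG : 1 ≤ s.G) (hN : s.pw * s.G ^ n ≤ N) :
    Run N readUnary s.mem (List.replicate n 1 ++ 0 :: i)
      (St.mem { s with pw := s.pw * s.G ^ n, f := 0 }) i [] := by
  induction n generalizing s with
  | zero =>
    rw [pow_zero, mul_one]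
    refine .loop_true (o := []) (o' := []) (v' := St.mem { s with f := 0 }) (i' := i) ?_
      (Run.seq_nil (.read_head 0 (Reg.set_f _ _) (by omega))
        (Run.seq_nil (Run.asg 0 rfl (Reg.set_f _ _) (by omega)) (.ite_false rfl (.skip _ _))))
      (.loop_false rfl)
    change s.f ≠ 0
    omega
  | succ n ih =>
    have h1 : s.pw * s.G * s.G ^ n = s.pw * s.G ^ (n + 1) := by ring
    have := ih { s with pw := s.pw * s.G, f := 1 } rfl hG (h1.trans_le hN)
    dsimp only at this
    rw [h1] at this
    refine .loop_true (o := []) (o' := []) ?_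
      (Run.seq_nil (.read_head 1 (Reg.set_f _ _) h2)
        (Run.seq_nil (Run.asg 1 rfl (Reg.set_f _ _) (by omega))
          (.ite_true one_ne_zero (Run.asg (s.pw * s.G) rfl (Reg.set_pw _ _) ?_)))) this
    · change s.f ≠ 0
      omega
    · refine le_trans ?_ hN
      rw [← h1]
      exact Nat.le_mul_of_pos_right _ (Nat.pow_pos hG)

/-- Invariant: `Z` holds the leading bits of `z`, with `n` bits still to come. -/
theorem run_readDigits {N z : ℕ} (n : ℕ) (s : St) (i : List ℕ) (hpw : s.pw = 2 ^ n)
    (hZ : s.Z = z / 2 ^ n) (h2 : 2 ≤ N) (hpN : 2 ^ n ≤ N) (hz : z ≤ N) :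
    ∃ f', Run N readDigits s.mem (digitsBE 2 n z ++ i)
      (St.mem { s with pw := 1, Z := z, f := f' }) i [] := by
  induction n generalizing s with
  | zero =>
    rw [pow_zero] at hpw hZ
    rw [Nat.div_one] at hZ
    refine ⟨s.f, ?_⟩
    have h1 : s = { s with pw := 1, Z := z } := by rw [← hpw, ← hZ]
    rw [← h1]
    refine .loop_false ?_
    change s.pw - 1 = 0
    omega
  | succ n ih =>
    have hp : 2 ^ n ≤ N := (Nat.pow_le_pow_right two_pos n.le_succ).trans hpN
    obtain ⟨f', hr⟩ := ih { s with pw := 2 ^ n, Z := z / 2 ^ n, f := z / 2 ^ n % 2 + 1 } rfl rfl hp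
    refine ⟨f', .loop_true (o := []) (o' := []) ?_
      (Run.seq_nil (.read_head (z / 2 ^ n % 2) (Reg.set_f _ _) (by omega))
        (Run.seq_nil (Run.asg (z / 2 ^ n) ?_ (Reg.set_Z _ _) ((Nat.div_le_self _ _).trans hz))
          (Run.asg (2 ^ n) ?_ (Reg.set_pw _ _) hp))) hr⟩
    · change s.pw - 1 ≠ 0
      have := Nat.one_lt_pow (n := n + 1) (by omega) one_lt_two
      omega
    · change 2 * s.Z + (z / 2 ^ n % 2 + 1 - 1) = z / 2 ^ n
      rw [hZ, pow_succ, ← Nat.div_div_eq_div_mul]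
      omega
    · change s.pw / 2 = 2 ^ n
      rw [hpw, pow_succ, Nat.mul_div_cancel _ two_pos]

theorem run_readCode {N g z : ℕ} (s : St) (i : List ℕ) (hg : 0 < g) (hG : s.G = 2 ^ g)
    (hN : s.G * (z + 1) ≤ N) :
    ∃ f', Run N readCode s.mem (bitStream (codeword g z) ++ i)
      (St.mem { s with pw := 1, Z := z, f := f' }) i [] := by
  have hb : 1 < 2 ^ g := Nat.one_lt_two_pow hg.ne'
  have hG1 : 2 ≤ s.G := by omega
  have h2N : 2 ≤ N := by nlinarith
  have hzN : z ≤ N := by nlinarith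
  set j := Nat.clog (2 ^ g) (z + 1) with hj
  have hpw : s.G ^ j ≤ N := by
    rw [hG]
    rw [hG] at hN
    exact (pow_clog_le hb).trans hN
  have hpw2 : s.G ^ j = 2 ^ (j * g) := by rw [hG, ← pow_mul, mul_comm]
  -- The announced groups have room for all bits of `z`, so starting from `Z = 0` satisfies the
  -- invariant of `run_readDigits`.
  have hzj : z / 2 ^ (j * g) = 0 := by
    have := Nat.le_pow_clog hb (z + 1)
    rw [← hj, ← hG, hpw2] at this
    exact Nat.div_eq_of_lt (by omega)
  have h1 := run_readUnary (N := N) j { s with pw := 1, f := 1 } (digitsBE 2 (j * g) z ++ i) rfl h2N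
    (by change 1 ≤ s.G; omega) (by change 1 * s.G ^ j ≤ N; omega)
  obtain ⟨f', h2⟩ := run_readDigits (N := N) (z := z) (j * g)
    { s with pw := 1 * s.G ^ j, f := 0, Z := 0 } i
    (by change 1 * s.G ^ j = _; rw [one_mul, hpw2]) hzj.symm h2N (hpw2 ▸ hpw) hzN
  refine ⟨f', ?_⟩
  rw [bitStream_codeword, ← hj, List.append_assoc, List.cons_append]
  exact Run.seq_nil (Run.asg 1 rfl (Reg.set_pw _ _) (by omega)) <|
    Run.seq_nil (Run.asg 1 rfl (Reg.set_f _ _) (by omega)) <|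
    Run.seq_nil h1 <|
    Run.seq_nil (Run.asg 0 rfl (Reg.set_Z _ _) (Nat.zero_le _)) h2

/-! ### Initialization -/

/-- Powers of expressions. -/
def Expr.npow {m : ℕ} (e : Expr m) : ℕ → Expr m
  | 0 => 1
  | n + 1 => e.npow n * e

theorem Expr.eval_npow {m : ℕ} (e : Expr m) (n : ℕ) (v : Mem m) :
    (e.npow n).eval v = e.eval v ^ n := by
  induction n with
  | zero => rfl
  | succ n ih =>
    rw [pow_succ, ← ih]
    rfl

open Var in
/-- The parameters of the code: the number `sk` of contexts, the length `B` of the blocks, and the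
power of two `G` that belongs to a group of bits. -/
def initProg (k A : ℕ) : Prog 25 :=
  Reg.sk ≔ Expr.npow sg k ;; Reg.y ≔ sg ;; Reg.L ≔ 0 ;; .loop y (Reg.y ≔ y / 2 ;; Reg.L ≔ L + 1) ;;
  Reg.B ≔ .const (A ^ 2) * (sk * r * L) ;;
  Reg.c ≔ .const A * (sk * r * L) ;; Reg.G ≔ 1 ;; .loop c (Reg.G ≔ G * 2 ;; Reg.c ≔ c - 1)

theorem run_initProg {N k A : ℕ} (s : St) (i : List ℕ)
    (hσ : s.sg ≤ N) (hk : s.sg ^ k ≤ N) (hL : s.sg.size ≤ N)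
    (hB : A ^ 2 * (s.sg ^ k * s.r * s.sg.size) ≤ N)
    (hg : A * (s.sg ^ k * s.r * s.sg.size) ≤ N)
    (hG : 2 ^ (A * (s.sg ^ k * s.r * s.sg.size)) ≤ N) :
    Run N (initProg k A) s.mem i
      (St.mem { s with
        sk := s.sg ^ k, y := 0, L := s.sg.size, B := A ^ 2 * (s.sg ^ k * s.r * s.sg.size), c := 0,
        G := 2 ^ (A * (s.sg ^ k * s.r * s.sg.size)) }) i [] := by
  set u := s.sg ^ k * s.r * s.sg.size with hu
  have h1N : 1 ≤ N := Nat.one_le_two_pow.trans hG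
  -- Halving `σ` until it vanishes takes exactly `σ.size` rounds.
  let st : ℕ → St := fun j => { s with sk := s.sg ^ k, y := s.sg / 2 ^ j, L := j }
  have hloop : Run N (.loop Var.y (Reg.y ≔ Var.y / 2 ;; Reg.L ≔ Var.L + 1))
      (st 0).mem i (st s.sg.size).mem i [] := by
    refine Run.loop_iterate (fun j => (st j).mem) i s.sg.size (fun j hj => ⟨?_, ?_⟩) ?_
    · change s.sg / 2 ^ j ≠ 0
      exact (Nat.div_pos (Nat.lt_size.1 hj) (by positivity)).ne'
    · refine Run.seq_nil (Run.asg (s.sg / 2 ^ (j + 1)) ?_ (Reg.set_y _ _) ?_) <|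
        Run.asg (j + 1) rfl (Reg.set_L _ _) (by omega)
      · change s.sg / 2 ^ j / 2 = _
        rw [Nat.div_div_eq_div_mul, pow_succ]
      · exact (Nat.div_le_self _ _).trans hσ
    · change s.sg / 2 ^ s.sg.size = 0
      exact Nat.div_eq_of_lt (Nat.lt_size_self _)
  have h0 : (st 0).mem = St.mem { { { s with sk := s.sg ^ k } with y := s.sg } with L := 0 } := by
    simp [st]
  have h1 : st s.sg.size = { s with sk := s.sg ^ k, y := 0, L := s.sg.size } := by
    have : s.sg / 2 ^ s.sg.size = 0 := Nat.div_eq_of_lt (Nat.lt_size_self _)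
    simp [st, this]
  rw [h0, h1] at hloop
  let st' : ℕ → St := fun j => { s with
    sk := s.sg ^ k, y := 0, L := s.sg.size, B := A ^ 2 * u, c := A * u - j, G := 2 ^ j }
  have hloop' : Run N (.loop Var.c (Reg.G ≔ Var.G * 2 ;; Reg.c ≔ Var.c - 1))
      (st' 0).mem i (st' (A * u)).mem i [] := by
    refine Run.loop_iterate (fun j => (st' j).mem) i (A * u) (fun j hj => ⟨?_, ?_⟩) ?_
    · change A * u - j ≠ 0
      omega
    · exact Run.seq_nil (Run.asg (2 ^ (j + 1)) rfl (Reg.set_G _ _)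
          ((Nat.pow_le_pow_right two_pos hj).trans hG)) <|
        Run.asg (A * u - (j + 1)) rfl (Reg.set_c _ _) (by omega)
    · change A * u - A * u = 0
      omega
  have h0' : (st' 0).mem = St.mem { { { { s with sk := s.sg ^ k, y := 0, L := s.sg.size } with
      B := A ^ 2 * u } with c := A * u } with G := 1 } := by
    simp [st']
  have h1' : st' (A * u) = { s with
        sk := s.sg ^ k, y := 0, L := s.sg.size, B := A ^ 2 * u, c := 0, G := 2 ^ (A * u) } := by
    simp [st']
  rw [h0', h1'] at hloop'
  exact Run.seq_nil (Run.asg (s.sg ^ k) (Expr.eval_npow _ _ _) (Reg.set_sk _ _) hk) <|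
    Run.seq_nil (Run.asg s.sg rfl (Reg.set_y _ _) hσ) <|
    Run.seq_nil (Run.asg 0 rfl (Reg.set_L _ _) (Nat.zero_le _)) <|
    Run.seq_nil hloop <|
    Run.seq_nil (Run.asg (A ^ 2 * u) rfl (Reg.set_B _ _) hB) <|
    Run.seq_nil (Run.asg (A * u) rfl (Reg.set_c _ _) hg) <|
    Run.seq_nil (Run.asg 1 rfl (Reg.set_G _ _) h1N) hloop'

/-! ### The block coder -/

/-- The number that stands for a block `l` of at most `B` characters. -/
def blockIndex (σ r k B : ℕ) (l : List ℕ) : ℕ :=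
  rank σ r (σ ^ k) (l.length - k) (σ ^ l.length) (numVal σ l) * (B + 1) + l.length

/-- Coding a string block by block; the last block is shorter than the others. -/
def encodeBlocks {α : Type*} (B : ℕ) (code : List α → List Bool) (s : List α) : List Bool :=
  if _h : 0 < B ∧ B ≤ s.length then
    code (s.take B) ++ encodeBlocks B code (s.drop B)
  else code s
termination_by s.length
decreasing_by
  rw [List.length_drop]
  omega

open Var in
/-- Coding one block. -/
def encBlock (k : ℕ) : Prog 25 :=
  Reg.x ≔ 0 ;; Reg.ln ≔ 0 ;; readBlock ;; rankProg k ;; Reg.Z ≔ rk * (B + 1) + ln ;; writeCode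

open Var in
/-- The compressor. -/
def encProg (k A : ℕ) : Prog 25 :=
  initProg k A ;; Reg.f ≔ 1 ;; .loop f (encBlock k)

open Var in
/-- Decoding one block. -/
def decBlock (k : ℕ) : Prog 25 :=
  readCode ;; Reg.ln ≔ Z % (B + 1) ;; Reg.go ≔ Z / (B + 1) ;; Reg.x ≔ 0 ;; rankProg k ;;
  .loop (go - rk + (rk - go)) (Reg.x ≔ x + 1 ;; rankProg k) ;;
  Reg.L ≔ sg ;; Reg.Z ≔ x ;; Reg.pw ≔ S ;; writeDigits ;; Reg.go ≔ 1 - (B - ln)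

open Var in
/-- The decompressor. -/
def decProg (k A : ℕ) : Prog 25 :=
  initProg k A ;; Reg.go ≔ 1 ;; .loop go (decBlock k)

/-- The registers that hold the parameters of the code. -/
def St.HasParams (σ r k g B : ℕ) (s : St) : Prop :=
  s.sg = σ ∧ s.r = r ∧ s.sk = σ ^ k ∧ s.G = 2 ^ g ∧ s.B = B

/-- The bounds under which the programs run in registers of size `N`. -/
structure Bounds (N σ r g B : ℕ) : Prop where
  two_le : 2 ≤ σ
  r_pos : 1 ≤ r
  g_pos : 0 < g
  B_pos : 0 < B
  le : 2 ^ g * (((σ * (B + r)) ^ B + 1) * (B + 1)) ≤ N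

theorem Bounds.pow_le {N σ r g B l : ℕ} (h : Bounds N σ r g B) (hl : l ≤ B) :
    (σ * (l + r)) ^ l ≤ (σ * (B + r)) ^ B := by
  have := h.two_le
  have := h.r_pos
  exact (Nat.pow_le_pow_left (Nat.mul_le_mul_left _ (by omega)) _).trans
    (Nat.pow_le_pow_right (by nlinarith) hl)

theorem Bounds.prod_le {N σ r g B : ℕ} (h : Bounds N σ r g B) :
    ((σ * (B + r)) ^ B + 1) * (B + 1) ≤ N :=
  (Nat.le_mul_of_pos_left _ (by positivity)).trans h.le

theorem Bounds.pow_le_N {N σ r g B l : ℕ} (h : Bounds N σ r g B) (hl : l ≤ B) :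
    (σ * (l + r)) ^ l ≤ N := by
  have h1 := h.pow_le hl
  have h2 := h.prod_le
  nlinarith

theorem Bounds.alphabet_pow_le {N σ r g B l : ℕ} (h : Bounds N σ r g B) (hl : l ≤ B) :
    σ ^ l ≤ (σ * (B + r)) ^ B :=
  (Nat.pow_le_pow_left (Nat.le_mul_of_pos_right _ (by have := h.r_pos; omega)) _).trans (h.pow_le hl)

theorem Bounds.B_le {N σ r g B : ℕ} (h : Bounds N σ r g B) : B + 1 ≤ N :=
  (Nat.le_mul_of_pos_left _ (by positivity)).trans h.prod_le

theorem Bounds.alphabet_le {N σ r g B : ℕ} (h : Bounds N σ r g B) : σ ≤ N := by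
  have h1 := h.alphabet_pow_le (l := 1) h.B_pos
  have h2 := h.prod_le
  rw [pow_one] at h1
  nlinarith

/-- The factor `2 ^ g` leaves room for `pw`, which may overshoot the index by one group of bits when
a code is written or read. -/
theorem Bounds.index_le {N σ r g B k : ℕ} (h : Bounds N σ r g B) {l : List ℕ} (hl : l.length ≤ B) :
    2 ^ g * (blockIndex σ r k B l + 1) ≤ N := by
  refine le_trans (Nat.mul_le_mul_left _ ?_) h.le
  have h1 := rank_le σ r (σ ^ k) (l.length - k) (σ ^ l.length) (numVal σ l)
  have h2 := h1.trans (h.alphabet_pow_le hl)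
  unfold blockIndex
  nlinarith [Nat.mul_le_mul_right (B + 1) h2]

/-- The flag `f` survives exactly when a full block was read, which is also the condition under
which `encodeBlocks` continues. -/
theorem run_encBlock {N σ r k g B : ℕ} (hb : Bounds N σ r g B) (s : St)
    (hs : s.HasParams σ r k g B) (hf : s.f ≠ 0) (inp : List ℕ) (hinp : ∀ a ∈ inp, a < σ) :
    ∃ s' : St, s'.HasParams σ r k g B ∧ (s'.f ≠ 0 ↔ B ≤ inp.length) ∧
      Run N (encBlock k) s.mem inp s'.mem (inp.drop B)
        (bitStream (codeword g (blockIndex σ r k B (inp.take B)))) := by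
  obtain ⟨rfl, rfl, hK, hG, rfl⟩ := hs
  have hσ2 := hb.two_le
  have hr1 := hb.r_pos
  set l := inp.take s.B with hl
  have hlB : l.length ≤ s.B := by simp [hl]
  have hBN : s.B ≤ N := by have := hb.B_le; omega
  have hlN : l.length ≤ N := hlB.trans hBN
  have hx : numVal s.sg l < s.sg ^ l.length := numVal_lt fun a ha => hinp a (List.mem_of_mem_take ha)
  have hxN : numVal s.sg l ≤ N := by
    have h1 := hb.alphabet_pow_le hlB
    have h2 := hb.prod_le
    nlinarith
  obtain ⟨f', hf', h1⟩ := run_readBlock (N := N) inp { s with x := 0, ln := 0 } hf (Nat.zero_le _) hBN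
    (by simp) hinp hb.alphabet_le (by
      have h1 := hb.alphabet_pow_le (le_refl s.B)
      have h2 := hb.prod_le
      nlinarith)
  simp only [Nat.sub_zero, Nat.zero_add, ← hl] at hf' h1
  change Run N readBlock _ inp (St.mem { s with x := numVal s.sg l, ln := l.length, f := f' }) _ _ at h1
  obtain ⟨a, b, c, d, e, f, g', h, p, q, t, h2⟩ := run_rankProg (N := N) (k := k)
    { s with x := numVal s.sg l, ln := l.length, f := f' } (inp.drop s.B) hxN hlN
    (by change 1 ≤ s.sg; omega) hr1 (hb.pow_le_N hlB)
  set Z := blockIndex s.sg s.r k s.B l with hZ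
  have hZN : 2 ^ g * (Z + 1) ≤ N := hb.index_le hlB
  have hZ' : rank s.sg s.r s.sk (l.length - k) (s.sg ^ l.length) (numVal s.sg l) * (s.B + 1) +
      l.length = Z := by rw [hK, hZ, blockIndex]
  refine ⟨_, ?_, ?_, Run.seq_nil (Run.asg 0 rfl (Reg.set_x _ _) (Nat.zero_le _)) <|
    Run.seq_nil (Run.asg 0 rfl (Reg.set_ln _ _) (Nat.zero_le _)) <|
    Run.seq_nil h1 <| Run.seq_nil h2 <|
    Run.seq_nil (Run.asg Z hZ' (Reg.set_Z _ _) (by nlinarith [Nat.one_le_two_pow (n := g)])) <|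
    run_writeCode (g := g) _ _ hb.g_pos hG (by dsimp only; rw [hG]; exact hZN)⟩
  · exact ⟨rfl, rfl, hK, hG, rfl⟩
  · exact hf'

/-- Induction along the recursion of `encodeBlocks`. When `B` divides the length, an empty block is
coded at the end. -/
theorem run_encLoop {N σ r k g B : ℕ} (hb : Bounds N σ r g B) (inp : List ℕ)
    (hinp : ∀ a ∈ inp, a < σ) (s : St) (hs : s.HasParams σ r k g B) (hf : s.f ≠ 0) :
    ∃ v' i', Run N (.loop Var.f (encBlock k)) s.mem inp v' i'
      (bitStream (encodeBlocks B (fun l => codeword g (blockIndex σ r k B l)) inp)) := by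
  induction inp using encodeBlocks.induct (B := B) generalizing s with
  | case1 inp h ih =>
    obtain ⟨s', hs', hf', h1⟩ := run_encBlock hb s hs hf inp hinp
    obtain ⟨v', i', h2⟩ := ih (fun a ha => hinp a (List.mem_of_mem_drop ha)) s' hs' (hf'.2 h.2)
    rw [encodeBlocks, dif_pos h, bitStream_append]
    exact ⟨v', i', .loop_true hf h1 h2⟩
  | case2 inp h =>
    obtain ⟨s', hs', hf', h1⟩ := run_encBlock hb s hs hf inp hinp
    have hlt : inp.length < B := by
      have := hb.B_pos
      omega
    rw [encodeBlocks, dif_neg h]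
    rw [List.take_of_length_le hlt.le] at h1
    refine ⟨s'.mem, inp.drop B, ?_⟩
    have h2 : s'.f = 0 := by
      by_contra h2
      exact absurd (hf'.1 h2) (by omega)
    have h3 := Run.loop_true (e := Var.f) (v := s.mem) hf h1
      (Run.loop_false (N := N) (e := Var.f) (v := s'.mem) h2)
    rwa [List.append_nil] at h3

/-- The rank is inverted by search: `x` counts up from 0 until its rank is the decoded one, and
`hinj` excludes an earlier stop. -/
theorem run_decBlock {N σ r k g B : ℕ} (hb : Bounds N σ r g B) (s : St)
    (hs : s.HasParams σ r k g B) (l : List ℕ) (hlB : l.length ≤ B) (hl : ∀ a ∈ l, a < σ)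
    (hinj : ∀ x < numVal σ l, rank σ r (σ ^ k) (l.length - k) (σ ^ l.length) x ≠
      rank σ r (σ ^ k) (l.length - k) (σ ^ l.length) (numVal σ l)) (i : List ℕ) :
    ∃ s' : St, s'.HasParams σ r k g B ∧ (s'.go ≠ 0 ↔ B ≤ l.length) ∧
      Run N (decBlock k) s.mem (bitStream (codeword g (blockIndex σ r k B l)) ++ i) s'.mem i l := by
  obtain ⟨rfl, rfl, hK, hG, rfl⟩ := hs
  have hσ2 := hb.two_le
  have hr1 := hb.r_pos
  have hBN : s.B ≤ N := by have := hb.B_le; omega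
  have hlN : l.length ≤ N := hlB.trans hBN
  have hx : numVal s.sg l < s.sg ^ l.length := numVal_lt hl
  have hSN : s.sg ^ l.length ≤ N := by
    have h1 := hb.alphabet_pow_le hlB
    have h2 := hb.prod_le
    nlinarith
  have hxN : numVal s.sg l ≤ N := hx.le.trans hSN
  set Z := blockIndex s.sg s.r k s.B l with hZ
  have hZN : 2 ^ g * (Z + 1) ≤ N := hb.index_le hlB
  let R : ℕ → ℕ := rank s.sg s.r s.sk (l.length - k) (s.sg ^ l.length)
  have hRN : ∀ x, R x ≤ N := fun x => (rank_le _ _ _ _ _ _).trans hSN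
  have hZ' : Z = R (numVal s.sg l) * (s.B + 1) + l.length := by
    simp only [hZ, blockIndex, R, hK]
  -- Lengths are at most `B`, so they can be read off as the remainder modulo `B + 1`.
  have hmod : Z % (s.B + 1) = l.length := by
    rw [hZ', Nat.add_comm, Nat.add_mul_mod_self_right, Nat.mod_eq_of_lt (by omega)]
  have hdiv : Z / (s.B + 1) = R (numVal s.sg l) := by
    rw [hZ', Nat.add_comm, Nat.add_mul_div_right _ _ (by omega), Nat.div_eq_of_lt (by omega),
      Nat.zero_add]
  obtain ⟨f₀, h1⟩ := run_readCode (N := N) (z := Z) s i hb.g_pos hG (by rw [hG]; exact hZN)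
  have rankAt : ∀ s₁ : St, s₁.sg = s.sg → s₁.r = s.r → s₁.sk = s.sk → s₁.ln = l.length → s₁.x ≤ N →
      ∃ a b c d e f g h p q t, Run N (rankProg k) s₁.mem i
      (St.mem { s₁ with
        rk := R s₁.x, S := s.sg ^ l.length,
        yy := a, ll := b, z := c, c := d, t := e, n := f, num := g, den := h, nx := p, dx := q,
        y := t }) i [] := by
    intro s₁ e1 e2 e3 e4 e5
    have := run_rankProg (N := N) (k := k) s₁ i e5 (by omega) (by omega) (by omega)
      (by rw [e1, e2, e4]; exact hb.pow_le_N hlB)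
    rw [show rank s₁.sg s₁.r s₁.sk (s₁.ln - k) (s₁.sg ^ s₁.ln) s₁.x = R s₁.x by
      rw [e1, e2, e3, e4], e1, e4] at this
    rw [← e1, ← e4]
    rw [← e1, ← e4] at this
    exact this
  let I : ℕ → St → Prop := fun j s' => ∃ a b c d e f g h p q t, s' = { s with
        pw := 1, Z := Z, f := f₀, ln := l.length, go := R (numVal s.sg l), x := j,
        rk := R j, S := s.sg ^ l.length,
        yy := a, ll := b, z := c, c := d, t := e, n := f, num := g, den := h, nx := p, dx := q,
        y := t }
  obtain ⟨a, b, c, d, e, f, g', h, p, q, t, h2⟩ := rankAt { s with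
        pw := 1, Z := Z, f := f₀, ln := l.length, go := R (numVal s.sg l), x := 0 }
        rfl rfl rfl rfl (Nat.zero_le _)
  have key := Run.loop_inv (N := N) (e := Var.go - Var.rk + (Var.rk - Var.go))
    (p := Reg.x ≔ Var.x + 1 ;; rankProg k) (i := i) I (numVal s.sg l) ?_ ?_ _
    ⟨a, b, c, d, e, f, g', h, p, q, t, rfl⟩
  · obtain ⟨s', ⟨a', b', c', d', e', f', g'', h', p', q', t', rfl⟩, h3⟩ := key
    have h4 := run_writeDigits (N := N) l.length { s with
        pw := s.sg ^ l.length, Z := numVal s.sg l, f := f₀, ln := l.length,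
        go := R (numVal s.sg l), x := numVal s.sg l, L := s.sg,
        rk := R (numVal s.sg l), S := s.sg ^ l.length,
        yy := a', ll := b', z := c', c := d', t := e', n := f', num := g'', den := h', nx := p',
        dx := q', y := t' } i hσ2 rfl hSN
    dsimp only at h4
    rw [digitsBE_numVal l hl] at h4
    refine ⟨_, ?_, ?_, Run.seq_nil h1 <|
      Run.seq_nil (Run.asg l.length hmod (Reg.set_ln _ _) hlN) <|
      Run.seq_nil (Run.asg (R (numVal s.sg l)) hdiv (Reg.set_go _ _) (hRN _)) <|
      Run.seq_nil (Run.asg 0 rfl (Reg.set_x _ _) (Nat.zero_le _)) <|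
      Run.seq_nil h2 <|
      Run.seq_nil h3 <|
      Run.seq_nil (Run.asg s.sg rfl (Reg.set_L _ _) hb.alphabet_le) <|
      Run.seq_nil (Run.asg (numVal s.sg l) rfl (Reg.set_Z _ _) hxN) <|
      Run.seq_nil (Run.asg (s.sg ^ l.length) rfl (Reg.set_pw _ _) hSN) <|
      Run.seq_out_nil h4 (Run.asg (1 - (s.B - l.length)) rfl (Reg.set_go _ _) (by omega))⟩
    · exact ⟨rfl, rfl, hK, hG, rfl⟩
    · change 1 - (s.B - l.length) ≠ 0 ↔ _
      omega
  · rintro j hj _ ⟨a, b, c, d, e, f, g, h, p, q, t, rfl⟩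
    obtain ⟨a', b', c', d', e', f', g'', h', p', q', t', h3⟩ := rankAt { s with
        pw := 1, Z := Z, f := f₀, ln := l.length, go := R (numVal s.sg l), x := j + 1,
        rk := R j, S := s.sg ^ l.length,
        yy := a, ll := b, z := c, c := d, t := e, n := f, num := g, den := h, nx := p, dx := q,
        y := t } rfl rfl rfl rfl (by change j + 1 ≤ N; omega)
    refine ⟨?_, _, ⟨a', b', c', d', e', f', g'', h', p', q', t', rfl⟩,
      Run.seq_nil (Run.asg (j + 1) rfl (Reg.set_x _ _) (by omega)) h3⟩
    change R (numVal s.sg l) - R j + (R j - R (numVal s.sg l)) ≠ 0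
    have : R j ≠ R (numVal s.sg l) := by
      simp only [R, hK]
      exact hinj j hj
    omega
  · rintro _ ⟨a, b, c, d, e, f, g, h, p, q, t, rfl⟩
    change R (numVal s.sg l) - R (numVal s.sg l) + (R (numVal s.sg l) - R (numVal s.sg l)) = 0
    omega

/-- The first block shorter than `B` ends the loop, so the decoder needs neither `n` nor the end of
its input. -/
theorem run_decLoop {N σ r k g B : ℕ} (hb : Bounds N σ r g B)
    (hinj : ∀ m n x y, x < y → y < σ ^ n → rank σ r (σ ^ k) m (σ ^ n) x ≠ rank σ r (σ ^ k) m (σ ^ n) y)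
    (l : List ℕ) (hl : ∀ a ∈ l, a < σ) (s : St) (hs : s.HasParams σ r k g B) (hgo : s.go ≠ 0) :
    ∃ v' i', Run N (.loop Var.go (decBlock k)) s.mem
      (bitStream (encodeBlocks B (fun l => codeword g (blockIndex σ r k B l)) l)) v' i' l := by
  induction l using encodeBlocks.induct (B := B) generalizing s with
  | case1 l h ih =>
    have hl' : ∀ a ∈ l.take B, a < σ := fun a ha => hl a (List.mem_of_mem_take ha)
    have hlen : (l.take B).length = B := by simp [h.2]
    obtain ⟨s', hs', hgo', h1⟩ := run_decBlock hb s hs (l.take B) hlen.le hl'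
      (fun x hx => hinj _ _ _ _ hx (numVal_lt hl'))
      (bitStream (encodeBlocks B (fun l => codeword g (blockIndex σ r k B l)) (l.drop B)))
    obtain ⟨v', i', h2⟩ := ih (fun a ha => hl a (List.mem_of_mem_drop ha)) s' hs' (hgo'.2 hlen.ge)
    refine ⟨v', i', ?_⟩
    rw [encodeBlocks, dif_pos h, bitStream_append]
    have h3 := Run.loop_true (e := Var.go) (v := s.mem) hgo h1 h2
    rwa [List.take_append_drop] at h3
  | case2 l h =>
    have hlt : l.length < B := by
      have := hb.B_pos
      omega
    obtain ⟨s', hs', hgo', h1⟩ := run_decBlock hb s hs l hlt.le hl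
      (fun x hx => hinj _ _ _ _ hx (numVal_lt hl)) []
    refine ⟨s'.mem, [], ?_⟩
    have h2 : s'.go = 0 := by
      by_contra h2
      exact absurd (hgo'.1 h2) (by omega)
    rw [encodeBlocks, dif_neg h]
    have h3 := Run.loop_true (e := Var.go) (v := s.mem) hgo h1
      (Run.loop_false (N := N) (e := Var.go) (v := s'.mem) h2)
    rwa [List.append_nil, List.append_nil] at h3

/-- The length of the groups of bits. -/
def groupSize (k A σ r : ℕ) : ℕ := A * (σ ^ k * r * σ.size)

/-- The length of the blocks. -/
def blockSize (k A σ r : ℕ) : ℕ := A ^ 2 * (σ ^ k * r * σ.size)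

theorem init_eq_mem (σ r : ℕ) : Mem.init 25 [σ, r] = St.mem { sg := σ, r := r } := by
  funext j
  fin_cases j <;> rfl

theorem run_initProg_params {N k A σ r : ℕ}
    (hb : Bounds N σ r (groupSize k A σ r) (blockSize k A σ r)) (i : List ℕ) :
    ∃ s : St, s.HasParams σ r k (groupSize k A σ r) (blockSize k A σ r) ∧
      Run N (initProg k A) (Mem.init 25 [σ, r]) i s.mem i [] := by
  have hG : 2 ^ groupSize k A σ r ≤ N := le_trans (Nat.le_mul_of_pos_right _ (by positivity)) hb.le
  have hg : groupSize k A σ r ≤ N := Nat.lt_two_pow_self.le.trans hG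
  have hA : 0 < A := by
    rcases Nat.eq_zero_or_pos A with rfl | h
    · have := hb.g_pos
      simp [groupSize] at this
    · exact h
  have hL : 0 < σ.size := Nat.size_pos.2 (by have := hb.two_le; omega)
  have hu : σ ^ k * r * σ.size ≤ groupSize k A σ r := Nat.le_mul_of_pos_left _ hA
  have hK : 0 < σ ^ k := Nat.pow_pos (by have := hb.two_le; omega)
  have hr := hb.r_pos
  rw [init_eq_mem]
  refine ⟨_, ?_, run_initProg _ i hb.alphabet_le ?_ ?_ ((Nat.le_succ _).trans hb.B_le) hg hG⟩
  · exact ⟨rfl, rfl, rfl, rfl, rfl⟩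
  · refine le_trans ?_ (hu.trans hg)
    rw [mul_assoc]
    exact Nat.le_mul_of_pos_right _ (Nat.mul_pos hr hL)
  · exact (Nat.le_mul_of_pos_left _ (Nat.mul_pos hK hr)).trans (hu.trans hg)

theorem run_encProg {N k A σ r : ℕ}
    (hb : Bounds N σ r (groupSize k A σ r) (blockSize k A σ r)) (l : List ℕ) (hl : ∀ a ∈ l, a < σ) :
    ∃ v' i', Run N (encProg k A) (Mem.init 25 [σ, r]) l v' i'
      (bitStream (encodeBlocks (blockSize k A σ r) (fun l => codeword (groupSize k A σ r)
        (blockIndex σ r k (blockSize k A σ r) l)) l)) := by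
  obtain ⟨s, hs, h1⟩ := run_initProg_params hb l
  obtain ⟨v', i', h2⟩ := run_encLoop hb l hl { s with f := 1 } hs one_ne_zero
  have := hb.alphabet_le
  have := hb.two_le
  exact ⟨v', i', Run.seq_nil h1 (Run.seq_nil (Run.asg 1 rfl (Reg.set_f _ _) (by omega)) h2)⟩

theorem run_decProg {N k A σ r : ℕ}
    (hb : Bounds N σ r (groupSize k A σ r) (blockSize k A σ r))
    (hinj : ∀ m n x y, x < y → y < σ ^ n → rank σ r (σ ^ k) m (σ ^ n) x ≠ rank σ r (σ ^ k) m (σ ^ n) y)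
    (l : List ℕ) (hl : ∀ a ∈ l, a < σ) :
    ∃ v' i', Run N (decProg k A) (Mem.init 25 [σ, r])
      (bitStream (encodeBlocks (blockSize k A σ r) (fun l => codeword (groupSize k A σ r)
        (blockIndex σ r k (blockSize k A σ r) l)) l)) v' i' l := by
  obtain ⟨s, hs, h1⟩ := run_initProg_params hb (bitStream (encodeBlocks (blockSize k A σ r)
    (fun l => codeword (groupSize k A σ r) (blockIndex σ r k (blockSize k A σ r) l)) l))
  obtain ⟨v', i', h2⟩ := run_decLoop hb hinj l hl { s with go := 1 } hs one_ne_zero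
  have := hb.alphabet_le
  have := hb.two_le
  exact ⟨v', i', Run.seq_nil h1 (Run.seq_nil (Run.asg 1 rfl (Reg.set_go _ _) (by omega)) h2)⟩

/-! ### The rank is injective and at most the inverse of the probability -/

/-- The adaptive probability of the last `m` digits of `y`. -/
noncomputable def prob (σ r K m y : ℕ) : ℝ := (probNum σ r K m y : ℝ) / probDen σ r K m y

/-- The factor `i = 0` belongs to the last digit; the others are those of the prefix `y / σ`. -/
theorem probNum_succ (σ r K m y : ℕ) : probNum σ r K (m + 1) y =
    (σ * windowCount σ K y m + r) * probNum σ r K m (y / σ) := by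
  unfold probNum probNumAux
  rw [prod_range_succ', mul_comm]
  congr 1
  · simp
  · refine prod_congr rfl fun i _ => ?_
    rw [Nat.div_div_eq_div_mul, ← pow_succ', Nat.add_sub_add_right]

theorem probDen_succ (σ r K m y : ℕ) : probDen σ r K (m + 1) y =
    (σ * (contextCount σ K y m + r)) * probDen σ r K m (y / σ) := by
  unfold probDen probDenAux
  rw [prod_range_succ', mul_comm]
  congr 1
  · simp
  · refine prod_congr rfl fun i _ => ?_
    rw [Nat.div_div_eq_div_mul, ← pow_succ', Nat.add_sub_add_right]

theorem probNum_pos {σ r : ℕ} (hr : 0 < r) (K m y : ℕ) : 0 < probNum σ r K m y := by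
  unfold probNum probNumAux
  exact prod_pos fun _ _ => by omega

theorem probDen_pos {σ r : ℕ} (hσ : 0 < σ) (hr : 0 < r) (K m y : ℕ) : 0 < probDen σ r K m y := by
  unfold probDen probDenAux
  exact prod_pos fun _ _ => Nat.mul_pos hσ (by omega)

theorem prob_pos {σ r : ℕ} (hσ : 0 < σ) (hr : 0 < r) (K m y : ℕ) : 0 < prob σ r K m y :=
  div_pos (by exact_mod_cast probNum_pos hr K m y) (by exact_mod_cast probDen_pos hσ hr K m y)

theorem prob_zero (σ r K y : ℕ) : prob σ r K 0 y = 1 := by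
  simp [prob, probNum, probDen, probNumAux, probDenAux]

theorem prob_succ (σ r K m y : ℕ) : prob σ r K (m + 1) y =
    ((σ * windowCount σ K y m + r : ℕ) : ℝ) / ((σ * (contextCount σ K y m + r) : ℕ) : ℝ) *
      prob σ r K m (y / σ) := by
  rw [prob, prob, probNum_succ, probDen_succ]
  push_cast
  rw [mul_div_mul_comm]

/-- In natural numbers, adding 1 on the right turns `<` into `≤`. This breaks ties in favour of
smaller numbers and makes the test a lexicographic linear order. -/
theorem better_iff {σ r : ℕ} (hσ : 0 < σ) (hr : 0 < r) (K m x y : ℕ) :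
    probNum σ r K m x * probDen σ r K m y <
      probNum σ r K m y * probDen σ r K m x + (if y < x then 1 else 0) ↔
    toLex (-prob σ r K m y, y) < toLex (-prob σ r K m x, x) := by
  have h1 : (0 : ℝ) < probDen σ r K m x := by exact_mod_cast probDen_pos hσ hr K m x
  have h2 : (0 : ℝ) < probDen σ r K m y := by exact_mod_cast probDen_pos hσ hr K m y
  rw [Prod.Lex.toLex_lt_toLex, neg_lt_neg_iff, neg_inj, prob, prob, div_lt_div_iff₀ h1 h2,
    div_eq_div_iff h2.ne' h1.ne']
  norm_cast
  split_ifs with h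
  · simp only [h, and_true]
    omega
  · simp [h]

/-- By transitivity the predecessors of `x` are predecessors of `y`, and `x` itself is a new one. -/
theorem rank_lt_rank {σ r : ℕ} (hσ : 0 < σ) (hr : 0 < r) {K m S x y : ℕ} (hx : x < S)
    (h : toLex (-prob σ r K m x, x) < toLex (-prob σ r K m y, y)) :
    rank σ r K m S x < rank σ r K m S y := by
  unfold rank
  rw [← card_filter, ← card_filter]
  refine card_lt_card ?_
  simp only [better_iff hσ hr]
  refine (ssubset_iff_of_subset ?_).2 ⟨x, ?_, ?_⟩
  · intro z hz
    rw [mem_filter] at hz ⊢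
    exact ⟨hz.1, hz.2.trans h⟩
  · rw [mem_filter, mem_range]
    exact ⟨hx, h⟩
  · simp

theorem rank_ne {σ r : ℕ} (hσ : 0 < σ) (hr : 0 < r) {K m S x y : ℕ} (hxy : x < y) (hy : y < S) :
    rank σ r K m S x ≠ rank σ r K m S y := by
  rcases lt_trichotomy (toLex (-prob σ r K m x, x)) (toLex (-prob σ r K m y, y)) with h | h | h
  · exact (rank_lt_rank hσ hr (hxy.trans hy) h).ne
  · have := congrArg (fun p => (ofLex p).2) h
    exact absurd this hxy.ne
  · exact (rank_lt_rank hσ hr hy h).ne'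

theorem sum_range_mul {M : Type*} [AddCommMonoid M] (f : ℕ → M) (b σ : ℕ) :
    ∑ y ∈ range (b * σ), f y = ∑ y ∈ range b, ∑ a ∈ range σ, f (y * σ + a) := by
  induction b with
  | zero => simp
  | succ b ih => rw [Nat.succ_mul, sum_range_add, ih, sum_range_succ]

/-- An earlier window whose context agrees matches for exactly one last digit `a`, namely its own;
otherwise it matches for none. -/
theorem sum_windowCount {σ K y : ℕ} (hσ : 0 < σ) (m : ℕ) :
    ∑ a ∈ range σ, windowCount σ K (y * σ + a) m = contextCount σ K (y * σ) m := by
  unfold windowCount contextCount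
  rw [sum_comm]
  refine sum_congr rfl fun j _ => ?_
  have key : ∀ a ∈ range σ, (if (y * σ + a) / σ ^ (j + 1) % (K * σ) = (y * σ + a) % (K * σ)
      then 1 else 0) =
      if a = y / σ ^ j % σ then (if y / σ ^ j / σ % K = y % K then 1 else 0) else 0 := by
    intro a ha
    rw [mem_range] at ha
    have h1 : (y * σ + a) / σ ^ (j + 1) = y / σ ^ j := by
      rw [pow_succ', ← Nat.div_div_eq_div_mul, Nat.add_comm, Nat.add_mul_div_right _ _ hσ,
        Nat.div_eq_of_lt ha, Nat.zero_add]
    have h2 : (y * σ + a) % (K * σ) = a + σ * (y % K) := by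
      rw [mul_comm K, Nat.mod_mul, Nat.add_comm (y * σ), Nat.add_mul_mod_self_right,
        Nat.mod_eq_of_lt ha, Nat.add_mul_div_right _ _ hσ, Nat.div_eq_of_lt ha, Nat.zero_add]
    rw [h1, h2, mul_comm K, Nat.mod_mul]
    rw [← ite_and]
    refine if_congr ?_ rfl rfl
    constructor
    · intro h
      have h3 := congrArg (· % σ) h
      have h4 := congrArg (· / σ) h
      simp only [Nat.add_mul_mod_self_left, Nat.mod_mod, Nat.mod_eq_of_lt ha,
        Nat.add_mul_div_left _ _ hσ, Nat.div_eq_of_lt ha, Nat.div_eq_of_lt (Nat.mod_lt _ hσ),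
        Nat.zero_add] at h3 h4
      exact ⟨h3.symm, h4⟩
    · rintro ⟨h3, h4⟩
      rw [h4, ← h3]
  rw [sum_congr rfl key, sum_ite_eq' (range σ), if_pos (mem_range.2 (Nat.mod_lt _ hσ))]
  have h5 : y * σ / σ ^ (j + 1) = y / σ ^ j := by
    rw [pow_succ', ← Nat.div_div_eq_div_mul, Nat.mul_div_cancel _ hσ]
  rw [h5, Nat.mul_div_cancel _ hσ]

theorem contextCount_add {σ K y a : ℕ} (ha : a < σ) (m : ℕ) :
    contextCount σ K (y * σ + a) m = contextCount σ K (y * σ) m := by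
  have hσ : 0 < σ := by omega
  have h : (y * σ + a) / σ = y * σ / σ := by
    rw [Nat.add_comm, Nat.add_mul_div_right _ _ hσ, Nat.div_eq_of_lt ha, Nat.zero_add,
      Nat.mul_div_cancel _ hσ]
  unfold contextCount
  simp only [pow_succ', ← Nat.div_div_eq_div_mul, h]

/-- For a fixed prefix, the numerators over the last digit sum to `σ * contextCount + σ * r`, the
denominator. The first `n` digits carry no factor and give `σ ^ n`. -/
theorem sum_prob {σ r : ℕ} (hσ : 0 < σ) (hr : 0 < r) (K m n : ℕ) :
    ∑ y ∈ range (σ ^ (n + m)), prob σ r K m y = (σ : ℝ) ^ n := by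
  induction m with
  | zero => simp [prob_zero]
  | succ m ih =>
    rw [← add_assoc, pow_succ, sum_range_mul, ← ih]
    refine sum_congr rfl fun y _ => ?_
    have hden : (0 : ℝ) < ((σ * (contextCount σ K (y * σ) m + r) : ℕ) : ℝ) := by
      exact_mod_cast Nat.mul_pos hσ (by omega)
    have : ∀ a ∈ range σ, prob σ r K (m + 1) (y * σ + a) =
        ((σ * windowCount σ K (y * σ + a) m + r : ℕ) : ℝ) *
          (prob σ r K m y / ((σ * (contextCount σ K (y * σ) m + r) : ℕ) : ℝ)) := by
      intro a ha
      rw [mem_range] at ha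
      rw [prob_succ, contextCount_add ha, Nat.add_comm (y * σ) a, Nat.add_mul_div_right _ _ hσ,
        Nat.div_eq_of_lt ha, Nat.zero_add]
      ring
    rw [sum_congr rfl this, ← sum_mul, ← Nat.cast_sum, sum_add_distrib, ← mul_sum,
      sum_windowCount hσ]
    rw [sum_const, card_range, smul_eq_mul, ← mul_add, mul_div_cancel₀ _ hden.ne']

/-- The number `x` and its predecessors in the order each have at least the probability of `x`, and
the total mass is `σ ^ n`. -/
theorem rank_succ_mul_prob_le {σ r : ℕ} (hσ : 0 < σ) (hr : 0 < r) {K m n x : ℕ}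
    (hx : x < σ ^ (n + m)) :
    ((rank σ r K m (σ ^ (n + m)) x : ℝ) + 1) * prob σ r K m x ≤ (σ : ℝ) ^ n := by
  rw [← sum_prob hσ hr K m n]
  set F := (range (σ ^ (n + m))).filter fun y =>
    toLex (-prob σ r K m y, y) < toLex (-prob σ r K m x, x) with hF
  have hrank : rank σ r K m (σ ^ (n + m)) x = F.card := by
    unfold rank
    rw [← card_filter]
    simp only [better_iff hσ hr, hF]
  have hxF : x ∉ F := by simp [hF]
  calc ((rank σ r K m (σ ^ (n + m)) x : ℝ) + 1) * prob σ r K m x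
      = ∑ _y ∈ insert x F, prob σ r K m x := by
        rw [sum_const, card_insert_of_notMem hxF, hrank, nsmul_eq_mul]
        push_cast
        ring
    _ ≤ ∑ y ∈ insert x F, prob σ r K m y := by
        refine sum_le_sum fun y hy => ?_
        rw [mem_insert] at hy
        rcases hy with rfl | hy
        · exact le_rfl
        · rw [hF, mem_filter, Prod.Lex.toLex_lt_toLex] at hy
          rcases hy.2 with h | h
          · exact (neg_lt_neg_iff.1 h).le
          · exact (neg_inj.1 h.1).ge
    _ ≤ ∑ y ∈ range (σ ^ (n + m)), prob σ r K m y := by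
        refine sum_le_sum_of_subset_of_nonneg ?_ fun y _ _ => (prob_pos hσ hr K m y).le
        intro y hy
        rw [mem_insert] at hy
        rcases hy with rfl | hy
        · exact mem_range.2 hx
        · exact (mem_filter.1 hy).1

/-! ### The followers of a context -/

theorem followers_nil {σ : ℕ} (w : List (Fin σ)) : followers w [] = [] := by
  rcases w with _ | ⟨a, w⟩ <;> simp [followers]

theorem followers_cons {σ : ℕ} (w s : List (Fin σ)) (c : Fin σ) :
    followers w (c :: s) =
      (if w <+: c :: s then (c :: s)[w.length]? else none).toList ++ followers w s := by
  unfold followers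
  rw [List.tails_cons, List.filterMap_cons]
  split <;> simp_all

/-- Equality up to order is enough, as only counts are used. Within the induction from the front,
the head position gains a follower only if `w` is the whole of `c :: s`. -/
theorem followers_append_singleton {σ : ℕ} (w s : List (Fin σ)) (b : Fin σ) :
    (followers w (s ++ [b])).Perm (followers w s ++ if w <:+ s then [b] else []) := by
  induction s with
  | nil =>
    rw [List.nil_append, followers_cons, followers_nil]
    rcases w with _ | ⟨a, w⟩ <;> simp
  | cons c s ih =>
    rw [List.cons_append, followers_cons, followers_cons, List.append_assoc]
    by_cases hw : w = c :: s
    · have h1 : ¬ w <:+ s := fun h => by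
        have := h.length_le
        simp [hw] at this
      rw [if_neg h1, List.append_nil] at ih
      subst hw
      simp only [← List.cons_append, List.prefix_append, if_true, List.prefix_rfl,
        List.suffix_rfl]
      simp only [List.length_cons]
      rw [List.getElem?_append_right (by simp), show (c :: s)[s.length + 1]? = none by simp]
      simp only [List.length_cons, Nat.sub_self, List.getElem?_cons_zero, Option.toList_some,
        Option.toList_none, List.nil_append]
      exact (List.Perm.append_left [b] ih).trans List.perm_append_comm
    · have h1 : (w <:+ c :: s) ↔ w <:+ s := by simp [List.suffix_cons_iff, hw]
      simp only [h1]
      refine List.Perm.append ?_ ih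
      have h2 : (if w <+: c :: (s ++ [b]) then (c :: (s ++ [b]))[w.length]? else none) =
          if w <+: c :: s then (c :: s)[w.length]? else none := by
        rw [← List.cons_append]
        by_cases h3 : w <+: c :: s
        · have h4 : w.length < (c :: s).length :=
            lt_of_le_of_ne h3.length_le fun h => hw (h3.eq_of_length h)
          rw [if_pos h3, if_pos (h3.trans (List.prefix_append _ _)), List.getElem?_append_left h4]
        · rw [if_neg h3]
          split_ifs with h5
          · have h6 : w = c :: s ++ [b] := by
              rcases List.prefix_concat_iff.1 h5 with h | h
              · exact h
              · exact absurd h h3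
            rw [h6, List.getElem?_eq_none le_rfl]
          · rfl
      rw [h2]

/-- The number of times that `a` follows the context `w` in `s`. -/
def followCount {σ : ℕ} (w s : List (Fin σ)) (a : Fin σ) : ℕ := (followers w s).count a

theorem followCount_append_singleton {σ : ℕ} (w s : List (Fin σ)) (b a : Fin σ) :
    followCount w (s ++ [b]) a = followCount w s a + if w <:+ s ∧ a = b then 1 else 0 := by
  unfold followCount
  rw [(followers_append_singleton w s b).count_eq, List.count_append]
  congr 1
  by_cases h : w <:+ s
  · by_cases hab : a = b
    · simp [h, hab]
    · simp [h, hab, Ne.symm hab]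
  · simp [h]

theorem sum_count {σ : ℕ} (l : List (Fin σ)) : ∑ a, l.count a = l.length := by
  induction l with
  | nil => simp
  | cons b l ih =>
    simp only [List.count_cons, sum_add_distrib, ih, List.length_cons]
    simp

theorem sum_followCount_append_singleton {σ : ℕ} (w s : List (Fin σ)) (b : Fin σ) :
    ∑ a, followCount w (s ++ [b]) a = ∑ a, followCount w s a + if w <:+ s then 1 else 0 := by
  simp only [followCount_append_singleton, sum_add_distrib]
  congr 1
  by_cases h : w <:+ s <;> simp [h]

theorem followCount_nil {σ : ℕ} (w : List (Fin σ)) (a : Fin σ) : followCount w [] a = 0 := by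
  simp [followCount, followers_nil]

/-- Only the windows that straddle the cut are lost. This makes coding the blocks independently
harmless. -/
theorem followCount_add_le {σ : ℕ} (w u v : List (Fin σ)) (a : Fin σ) :
    followCount w u a + followCount w v a ≤ followCount w (u ++ v) a := by
  induction v using List.reverseRecOn with
  | nil => simp [followCount_nil]
  | append_singleton v b ih =>
    rw [← List.append_assoc, followCount_append_singleton, followCount_append_singleton]
    have : (w <:+ v ∧ a = b) → (w <:+ u ++ v ∧ a = b) := fun h =>
      ⟨h.1.trans (List.suffix_append _ _), h.2⟩
    split_ifs <;> first | omega | (exfalso; tauto)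

theorem sum_followCount_le {σ : ℕ} (w s : List (Fin σ)) : ∑ a, followCount w s a ≤ s.length := by
  induction s using List.reverseRecOn with
  | nil => simp [followCount_nil]
  | append_singleton s b ih =>
    rw [sum_followCount_append_singleton, List.length_append, List.length_singleton]
    split_ifs <;> omega

theorem followCount_of_length_le {σ : ℕ} {w s : List (Fin σ)} (h : s.length ≤ w.length) (a : Fin σ) :
    followCount w s a = 0 := by
  induction s using List.reverseRecOn with
  | nil => simp [followCount_nil]
  | append_singleton s b ih =>
    rw [List.length_append, List.length_singleton] at h
    rw [followCount_append_singleton, ih (by omega), if_neg]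
    rintro ⟨h1, -⟩
    have := h1.length_le
    omega

/-! ### Counting windows of numbers and of strings -/

/-- The number that stands for a string. -/
def strVal {σ : ℕ} (s : List (Fin σ)) : ℕ := numVal σ (charStream s)

theorem charStream_eq_map {σ : ℕ} (s : List (Fin σ)) : charStream s = s.map Fin.val := by
  simp only [charStream, List.map_id']
  induction s with
  | nil => rfl
  | cons a s ih => exact congrArg (a.val :: ·) ih

theorem charStream_lt {σ : ℕ} (s : List (Fin σ)) : ∀ a ∈ charStream s, a < σ := by
  intro a ha
  rw [charStream_eq_map] at ha
  obtain ⟨b, -, rfl⟩ := List.mem_map.1 ha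
  exact b.2

theorem charStream_length {σ : ℕ} (s : List (Fin σ)) : (charStream s).length = s.length := by
  simp [charStream_eq_map]

theorem strVal_append_singleton {σ : ℕ} (s : List (Fin σ)) (a : Fin σ) :
    strVal (s ++ [a]) = strVal s * σ + a := by
  simp only [strVal, charStream_eq_map]
  rw [List.map_append, List.map_singleton, numVal_append_singleton]

theorem strVal_lt {σ : ℕ} (s : List (Fin σ)) : strVal s < σ ^ s.length := by
  rw [← charStream_length]
  exact numVal_lt (charStream_lt s)

theorem strVal_append {σ : ℕ} (s t : List (Fin σ)) :
    strVal (s ++ t) = strVal s * σ ^ t.length + strVal t := by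
  unfold strVal
  rw [← charStream_length t, ← numVal_append]
  simp [charStream_eq_map]

theorem strVal_inj {σ : ℕ} {s t : List (Fin σ)} (hl : s.length = t.length)
    (h : strVal s = strVal t) : s = t := by
  have h1 := digitsBE_numVal _ (charStream_lt s)
  have h2 := digitsBE_numVal _ (charStream_lt t)
  rw [charStream_length] at h1 h2
  have h3 : charStream s = charStream t := by
    rw [← h1, ← h2, hl]
    congr 1
  rw [charStream_eq_map, charStream_eq_map] at h3
  exact List.map_injective_iff.2 Fin.val_injective h3

theorem strVal_mod_eq_iff {σ : ℕ} {s w : List (Fin σ)} (hl : w.length ≤ s.length) :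
    strVal s % σ ^ w.length = strVal w ↔ w <:+ s := by
  obtain ⟨p, q, rfl, hq⟩ : ∃ p q, s = p ++ q ∧ q.length = w.length :=
    ⟨s.take (s.length - w.length), s.drop (s.length - w.length), (List.take_append_drop _ _).symm,
      by rw [List.length_drop]; omega⟩
  rw [strVal_append, hq, Nat.add_comm, Nat.add_mul_mod_self_right, ← hq,
    Nat.mod_eq_of_lt (strVal_lt q)]
  constructor
  · intro h
    rw [strVal_inj hq h]
    exact List.suffix_append _ _
  · intro h
    rw [List.suffix_iff_eq_drop] at h
    have : (p ++ q).length - w.length = p.length := by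
      rw [List.length_append]
      omega
    rw [this, List.drop_left] at h
    rw [h]

theorem div_strVal_append_singleton {σ : ℕ} (s : List (Fin σ)) (a : Fin σ) :
    strVal (s ++ [a]) / σ = strVal s := by
  have hσ : 0 < σ := a.pos
  rw [strVal_append_singleton, Nat.add_comm, Nat.add_mul_div_right _ _ hσ, Nat.div_eq_of_lt a.2,
    Nat.zero_add]

/-- Dividing by `σ ^ j` drops the last `j` characters. Appending a character adds the term `j = 0`
and shifts the others. -/
theorem sum_window_eq_followCount {σ : ℕ} (w s : List (Fin σ)) (a : Fin σ) :
    (∑ j ∈ range (s.length - w.length),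
      if strVal s / σ ^ j % (σ ^ w.length * σ) = strVal (w ++ [a]) then 1 else 0) =
      followCount w s a := by
  induction s using List.reverseRecOn with
  | nil => simp [followCount_nil]
  | append_singleton s b ih =>
    rw [followCount_append_singleton, ← ih]
    by_cases hl : w.length ≤ s.length
    · rw [show (s ++ [b]).length - w.length = s.length - w.length + 1 by simp; omega,
        sum_range_succ']
      congr 1
      · simp only [pow_succ', ← Nat.div_div_eq_div_mul, div_strVal_append_singleton]
      · refine if_congr ?_ rfl rfl
        have h1 := strVal_mod_eq_iff (s := s ++ [b]) (w := w ++ [a]) (by simpa using hl)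
        rw [List.length_append, List.length_singleton, pow_succ] at h1
        rw [pow_zero, Nat.div_one, h1]
        constructor
        · intro h
          obtain ⟨t, ht⟩ := h
          rw [← List.append_assoc] at ht
          have := List.append_inj' ht rfl
          exact ⟨⟨t, this.1⟩, by simpa using this.2⟩
        · rintro ⟨⟨t, rfl⟩, rfl⟩
          exact ⟨t, by simp⟩
    · have h1 : ¬ (w <:+ s ∧ a = b) := fun h => hl h.1.length_le
      rw [if_neg h1, show (s ++ [b]).length - w.length = 0 by simp; omega,
        show s.length - w.length = 0 by omega]
      rfl

theorem sum_context_eq_followCount {σ : ℕ} (w s : List (Fin σ)) :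
    (∑ j ∈ range (s.length - w.length),
      if strVal s / σ ^ j / σ % σ ^ w.length = strVal w then 1 else 0) =
      ∑ a, followCount w s a := by
  induction s using List.reverseRecOn with
  | nil => simp [followCount_nil]
  | append_singleton s b ih =>
    rw [sum_followCount_append_singleton, ← ih]
    by_cases hl : w.length ≤ s.length
    · rw [show (s ++ [b]).length - w.length = s.length - w.length + 1 by simp; omega,
        sum_range_succ']
      congr 1
      · simp only [pow_succ', ← Nat.div_div_eq_div_mul, div_strVal_append_singleton]
      · refine if_congr ?_ rfl rfl
        rw [pow_zero, Nat.div_one, div_strVal_append_singleton]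
        exact strVal_mod_eq_iff hl
    · have h1 : ¬ (w <:+ s) := fun h => hl h.length_le
      rw [if_neg h1, show (s ++ [b]).length - w.length = 0 by simp; omega,
        show s.length - w.length = 0 by omega]
      rfl

/-- The adaptive probability of a string. -/
noncomputable def strProb {σ : ℕ} (r k : ℕ) (s : List (Fin σ)) : ℝ :=
  prob σ r (σ ^ k) (s.length - k) (strVal s)

theorem strProb_append_singleton {σ : ℕ} (r k : ℕ) (p w : List (Fin σ)) (hw : w.length = k)
    (b : Fin σ) : strProb r k (p ++ w ++ [b]) =
      ((σ * followCount w (p ++ w) b + r : ℕ) : ℝ) /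
        ((σ * (∑ a, followCount w (p ++ w) a + r) : ℕ) : ℝ) * strProb r k (p ++ w) := by
  subst hw
  have h0 : 0 < σ := b.pos
  set m := (p ++ w).length - w.length with hm
  have h1 : (p ++ w ++ [b]).length - w.length = m + 1 := by simp [hm]; omega
  unfold strProb
  rw [h1, prob_succ, div_strVal_append_singleton, ← sum_window_eq_followCount,
    ← sum_context_eq_followCount]
  have hmod : strVal (p ++ w) % σ ^ w.length = strVal w :=
    (strVal_mod_eq_iff (by simp)).2 (List.suffix_append _ _)
  have hmod' : strVal (p ++ w ++ [b]) % (σ ^ w.length * σ) = strVal (w ++ [b]) := by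
    have := (strVal_mod_eq_iff (s := p ++ w ++ [b]) (w := w ++ [b]) (by simp)).2
      ⟨p, by simp⟩
    rwa [List.length_append, List.length_singleton, pow_succ] at this
  unfold windowCount contextCount
  simp only [pow_succ', ← Nat.div_div_eq_div_mul, div_strVal_append_singleton, hmod]
  rw [hmod']

/-! ### The probability of a string as a product over its contexts -/

/-- The probability that the urn of one context gives to the counts `t`. -/
noncomputable def urnProb {σ : ℕ} (r : ℕ) (t : Fin σ → ℕ) : ℝ :=
  (∏ a, ∏ i ∈ range (t a), ((σ : ℝ) * i + r)) / ∏ i ∈ range (∑ a, t a), ((σ : ℝ) * (i + r))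

theorem urnProb_zero {σ : ℕ} (r : ℕ) : urnProb r (fun _ : Fin σ => 0) = 1 := by
  simp [urnProb]

/-- One step of a Pólya urn in which each of the `σ` characters starts with weight `r / σ`. -/
theorem urnProb_add_single {σ : ℕ} (r : ℕ) (t : Fin σ → ℕ) (b : Fin σ) :
    urnProb r (fun a => t a + if a = b then 1 else 0) =
      (σ * t b + r) / (σ * ((∑ a, t a : ℕ) + r)) * urnProb r t := by
  have h1 : ∀ a, ∏ i ∈ range (t a + if a = b then 1 else 0), ((σ : ℝ) * i + r) =
      (∏ i ∈ range (t a), ((σ : ℝ) * i + r)) * if a = b then (σ : ℝ) * t a + r else 1 := by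
    intro a
    split_ifs
    · rw [prod_range_succ]
    · simp
  have h2 : ∑ a, (t a + if a = b then 1 else 0) = ∑ a, t a + 1 := by
    simp [sum_add_distrib]
  unfold urnProb
  rw [h2, prod_range_succ, prod_congr rfl fun a _ => h1 a, prod_mul_distrib, prod_ite_eq' univ b,
    if_pos (mem_univ b), mul_div_mul_comm, mul_comm]

theorem urnProb_pos {σ r : ℕ} (hσ : 0 < σ) (hr : 0 < r) (t : Fin σ → ℕ) : 0 < urnProb r t := by
  unfold urnProb
  have hσ' : (0 : ℝ) < σ := by exact_mod_cast hσ
  have hr' : (0 : ℝ) < r := by exact_mod_cast hr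
  exact div_pos (prod_pos fun a _ => prod_pos fun i _ => by positivity)
    (prod_pos fun i _ => by positivity)

/-- Appending a character is a draw from the urn of the last `k` characters and leaves the other
urns alone; the first `k` characters touch no urn. -/
theorem strProb_eq_prod {σ : ℕ} (r k : ℕ) (s : List (Fin σ)) :
    strProb r k s = ∏ w : Fin k → Fin σ, urnProb r (followCount (List.ofFn w) s) := by
  have hzero : ∀ s : List (Fin σ), s.length ≤ k →
      strProb r k s = ∏ w : Fin k → Fin σ, urnProb r (followCount (List.ofFn w) s) := by
    intro s hs
    have : ∀ w : Fin k → Fin σ, followCount (List.ofFn w) s = fun _ => 0 := fun w =>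
      funext fun a => followCount_of_length_le (by simpa using hs) a
    simp [this, urnProb_zero, strProb, prob_zero, Nat.sub_eq_zero_of_le hs]
  induction s using List.reverseRecOn with
  | nil => exact hzero _ (Nat.zero_le _)
  | append_singleton s b ih =>
    by_cases hl : k ≤ s.length
    · obtain ⟨p, w₀, rfl⟩ : ∃ p, ∃ w₀ : Fin k → Fin σ, s = p ++ List.ofFn w₀ := by
        have hd : (s.drop (s.length - k)).length = k := by rw [List.length_drop]; omega
        refine ⟨s.take (s.length - k), fun i => (s.drop (s.length - k)).get (i.cast hd.symm), ?_⟩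
        conv_lhs => rw [← List.take_append_drop (s.length - k) s]
        congr 1
        refine List.ext_get (by simp [hd]) fun i h1 h2 => by simp
      have h1 : ∀ w : Fin k → Fin σ, urnProb r (followCount (List.ofFn w) (p ++ List.ofFn w₀ ++ [b])) =
          (if w = w₀ then ((σ : ℝ) * followCount (List.ofFn w₀) (p ++ List.ofFn w₀) b + r) /
            (σ * ((∑ a, followCount (List.ofFn w₀) (p ++ List.ofFn w₀) a : ℕ) + r)) else 1) *
          urnProb r (followCount (List.ofFn w) (p ++ List.ofFn w₀)) := by
        intro w
        have hw : List.ofFn w <:+ p ++ List.ofFn w₀ ↔ w = w₀ := by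
          constructor
          · rintro ⟨q, hq⟩
            exact List.ofFn_injective (List.append_inj' hq (by simp)).2
          · rintro rfl
            exact List.suffix_append _ _
        have h2 : followCount (List.ofFn w) (p ++ List.ofFn w₀ ++ [b]) =
            fun a => followCount (List.ofFn w) (p ++ List.ofFn w₀) a +
              if w = w₀ ∧ a = b then 1 else 0 := by
          funext a
          simp only [followCount_append_singleton, hw]
        rw [h2]
        by_cases hww : w = w₀
        · subst hww
          simp only [true_and, if_true]
          exact urnProb_add_single r _ b
        · simp [hww]
      rw [strProb_append_singleton r k p _ (by simp) b, ih, prod_congr rfl fun w _ => h1 w,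
        prod_mul_distrib, prod_ite_eq' univ w₀, if_pos (mem_univ _)]
      push_cast
      rfl
    · exact hzero _ (by simp; omega)

/-! ### Entropies of counts -/

/-- The number of bits of the empirical entropy of the counts `t`. -/
noncomputable def countEntropy {ι : Type*} [Fintype ι] (t : ι → ℕ) : ℝ :=
  ∑ a, (t a : ℝ) * Real.logb 2 ((∑ b, t b : ℕ) / t a)

theorem countEntropy_term_nonneg {ι : Type*} [Fintype ι] (t : ι → ℕ) (a : ι) :
    0 ≤ (t a : ℝ) * Real.logb 2 ((∑ b, t b : ℕ) / t a) := by
  rcases Nat.eq_zero_or_pos (t a) with h | h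
  · simp [h]
  · have h1 : (0 : ℝ) < t a := by exact_mod_cast h
    refine mul_nonneg h1.le (Real.logb_nonneg one_lt_two ((one_le_div h1).2 ?_))
    exact_mod_cast single_le_sum (f := t) (fun _ _ => Nat.zero_le _) (mem_univ a)

/-- Gibbs' inequality, from `log x ≤ x - 1`. The hypothesis only serves to make `T a` positive
wherever `t a` is. -/
theorem countEntropy_le_cross {ι : Type*} [Fintype ι] {t T : ι → ℕ} (h : ∀ a, t a ≤ T a) :
    countEntropy t ≤ ∑ a, (t a : ℝ) * Real.logb 2 ((∑ b, T b : ℕ) / T a) := by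
  rw [← sub_nonpos, countEntropy, ← sum_sub_distrib]
  set n : ℕ := ∑ b, t b with hn
  set N : ℕ := ∑ b, T b with hN
  have hlog : 0 < Real.log 2 := Real.log_pos one_lt_two
  rcases Nat.eq_zero_or_pos N with hN0 | hN0
  · have : ∀ a, t a = 0 := fun a => by
      have := (sum_eq_zero_iff.1 (hN.symm.trans hN0)) a (mem_univ a)
      have := h a
      omega
    simp [this]
  have hN0' : (0 : ℝ) < N := by exact_mod_cast hN0
  calc _ ≤ ∑ a, ((n : ℝ) * T a / N - t a) / Real.log 2 := by
        refine sum_le_sum fun a _ => ?_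
        rcases Nat.eq_zero_or_pos (t a) with h0 | h0
        · simp only [h0, Nat.cast_zero, zero_mul, sub_zero]
          positivity
        · have ht : (0 : ℝ) < t a := by exact_mod_cast h0
          have hT : (0 : ℝ) < T a := by exact_mod_cast h0.trans_le (h a)
          have hn' : (0 : ℝ) < n := by
            exact_mod_cast h0.trans_le (single_le_sum (f := t) (fun _ _ => Nat.zero_le _) (mem_univ a))
          rw [← mul_sub, ← Real.logb_div (by positivity) (by positivity), Real.logb, ← mul_div_assoc]
          refine div_le_div_of_nonneg_right ?_ hlog.le
          have h1 := Real.log_le_sub_one_of_pos (x := (n : ℝ) / t a / (N / T a)) (by positivity)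
          calc (t a : ℝ) * Real.log ((n : ℝ) / t a / (N / T a))
              ≤ t a * ((n : ℝ) / t a / (N / T a) - 1) := mul_le_mul_of_nonneg_left h1 ht.le
            _ = _ := by field_simp
    _ = 0 := by
        rw [← sum_div, sum_sub_distrib, ← sum_div, ← mul_sum, ← Nat.cast_sum, ← Nat.cast_sum, ← hn,
          ← hN, mul_div_cancel_right₀ _ hN0'.ne', sub_self, zero_div]

/-- Both counts are charged at the ideal code lengths of `T`, which are nonnegative; this can only
increase each cost. -/
theorem countEntropy_add_le {ι : Type*} [Fintype ι] {t t' T : ι → ℕ} (h : ∀ a, t a + t' a ≤ T a) :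
    countEntropy t + countEntropy t' ≤ countEntropy T := by
  calc _ ≤ ∑ a, (t a : ℝ) * Real.logb 2 ((∑ b, T b : ℕ) / T a) +
        ∑ a, (t' a : ℝ) * Real.logb 2 ((∑ b, T b : ℕ) / T a) :=
        add_le_add (countEntropy_le_cross fun a => (Nat.le_add_right _ _).trans (h a))
          (countEntropy_le_cross fun a => (Nat.le_add_left _ _).trans (h a))
    _ = ∑ a, ((t a : ℝ) + t' a) * Real.logb 2 ((∑ b, T b : ℕ) / T a) := by
        rw [← sum_add_distrib]
        exact sum_congr rfl fun a _ => by ring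
    _ ≤ countEntropy T := by
        refine sum_le_sum fun a _ => ?_
        rcases Nat.eq_zero_or_pos (T a) with h0 | h0
        · simp [h0]
        · refine mul_le_mul_of_nonneg_right (by exact_mod_cast h a) ?_
          have h1 : (0 : ℝ) < T a := by exact_mod_cast h0
          refine Real.logb_nonneg one_lt_two ((one_le_div h1).2 ?_)
          exact_mod_cast single_le_sum (f := T) (fun _ _ => Nat.zero_le _) (mem_univ a)

/-- The sum of `|w_s| H₀(w_s)` over the contexts `w` of length `k`. -/
noncomputable def contextEntropy {σ : ℕ} (k : ℕ) (s : List (Fin σ)) : ℝ :=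
  ∑ w : Fin k → Fin σ, countEntropy (followCount (List.ofFn w) s)

theorem contextEntropy_add_le {σ : ℕ} (k : ℕ) (u v : List (Fin σ)) :
    contextEntropy k u + contextEntropy k v ≤ contextEntropy k (u ++ v) := by
  unfold contextEntropy
  rw [← sum_add_distrib]
  exact sum_le_sum fun w _ => countEntropy_add_le fun a => followCount_add_le _ u v a

theorem length_mul_entropy0 {σ : ℕ} (l : List (Fin σ)) :
    (l.length : ℝ) * entropy0 l = countEntropy fun a => l.count a := by
  unfold entropy0 countEntropy
  rw [sum_count, mul_sum]
  refine sum_congr rfl fun a _ => ?_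
  rcases Nat.eq_zero_or_pos l.length with h | h
  · simp [List.length_eq_zero_iff.1 h]
  · have : (0 : ℝ) < l.length := by exact_mod_cast h
    field_simp

theorem followers_empty {σ : ℕ} (s : List (Fin σ)) : followers [] s = s := by
  induction s with
  | nil => exact followers_nil []
  | cons a s ih => simp [followers_cons, ih]

theorem length_mul_entropy {σ : ℕ} (k : ℕ) (s : List (Fin σ)) :
    (s.length : ℝ) * entropy k s = contextEntropy k s := by
  unfold entropy contextEntropy
  have h : ∀ w : Fin k → Fin σ, ((followers (List.ofFn w) s).length : ℝ) *
      entropy0 (followers (List.ofFn w) s) = countEntropy (followCount (List.ofFn w) s) := fun w =>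
    length_mul_entropy0 _
  split_ifs with hk
  · subst hk
    rw [Fintype.sum_unique, ← h]
    simp [followers_empty]
  · simp only [h]
    rcases Nat.eq_zero_or_pos s.length with h0 | h0
    · rw [List.length_eq_zero_iff.1 h0]
      have : ∀ w : Fin k → Fin σ, followCount (List.ofFn w) ([] : List (Fin σ)) = fun _ => 0 :=
        fun w => funext fun a => followCount_nil _ a
      simp [this, countEntropy]
    · have : (0 : ℝ) < s.length := by exact_mod_cast h0
      field_simp

open Real

/-! ### The cost of a context in the adaptive code -/

/-- In the multinomial expansion of `(∑ t a / n) ^ n = 1`, the term with exponents `t` is at most 1;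
its logarithm is the claim. -/
theorem log_factorial_le {ι : Type*} [Fintype ι] [DecidableEq ι] (t : ι → ℕ) :
    logb 2 ((∑ a, t a).factorial : ℝ) - ∑ a, logb 2 ((t a).factorial : ℝ) ≤ countEntropy t := by
  set n := ∑ a, t a with hn
  have hfac : ∀ j : ℕ, (0 : ℝ) < (j.factorial : ℝ) := fun j => by exact_mod_cast j.factorial_pos
  rcases Nat.eq_zero_or_pos n with h0 | h0
  · have h1 : ∀ a, t a = 0 := fun a => sum_eq_zero_iff.1 (hn.symm.trans h0) a (mem_univ a)
    simp [h0, h1, countEntropy]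
  have hn' : (0 : ℝ) < n := by exact_mod_cast h0
  have key : (Nat.multinomial univ t : ℝ) * ∏ a, ((t a : ℝ) / n) ^ t a ≤ 1 := by
    have h1 := Finset.sum_pow_eq_sum_piAntidiag (univ : Finset ι) (fun a => (t a : ℝ) / n) n
    have h2 : ∑ a, (t a : ℝ) / n = 1 := by
      rw [← sum_div, ← Nat.cast_sum, ← hn, div_self hn'.ne']
    rw [h2, one_pow] at h1
    rw [h1]
    refine single_le_sum (f := fun k : ι → ℕ =>
      (Nat.multinomial univ k : ℝ) * ∏ a, ((t a : ℝ) / n) ^ k a) (fun k _ => by positivity) ?_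
    simp [mem_piAntidiag, hn]
  have hspec : (∏ a, ((t a).factorial : ℝ)) * Nat.multinomial univ t = (n.factorial : ℝ) := by
    exact_mod_cast Nat.multinomial_spec univ t
  have hpow : ∀ a, (0 : ℝ) < ((t a : ℝ) / n) ^ t a := by
    intro a
    rcases Nat.eq_zero_or_pos (t a) with h | h
    · simp [h]
    · have : (0 : ℝ) < t a := by exact_mod_cast h
      positivity
  have hprod : (0 : ℝ) < ∏ a, ((t a : ℝ) / n) ^ t a := prod_pos fun a _ => hpow a
  have hM : (0 : ℝ) < Nat.multinomial univ t := by exact_mod_cast Nat.multinomial_pos univ t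
  have h3 : logb 2 (n.factorial : ℝ) =
      ∑ a, logb 2 ((t a).factorial : ℝ) + logb 2 (Nat.multinomial univ t : ℝ) := by
    rw [← hspec, logb_mul (prod_pos fun a _ => hfac _).ne' hM.ne',
      logb_prod _ _ fun a _ => (hfac _).ne']
  have h4 : logb 2 (Nat.multinomial univ t : ℝ) + ∑ a, (t a : ℝ) * logb 2 ((t a : ℝ) / n) ≤ 0 := by
    have h5 := logb_nonpos one_lt_two (mul_pos hM hprod).le key
    rw [logb_mul hM.ne' hprod.ne', logb_prod _ _ fun a _ => (hpow a).ne'] at h5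
    simpa only [logb_pow] using h5
  have h6 : ∑ a, (t a : ℝ) * logb 2 ((t a : ℝ) / n) = -countEntropy t := by
    rw [countEntropy, ← sum_neg_distrib]
    refine sum_congr rfl fun a _ => ?_
    rw [← hn, ← inv_div, logb_inv]
    ring
  linarith

/-- The rising factorial is `n!` times a binomial coefficient with lower index `r - 1`, at most `(n
+ r) ^ r`. -/
theorem log_rising_le {r : ℕ} (hr : 0 < r) (n : ℕ) :
    logb 2 (∏ i ∈ range n, ((i : ℝ) + r)) ≤ logb 2 (n.factorial : ℝ) + r * logb 2 (n + r) := by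
  have h1 : ∏ i ∈ range n, ((i : ℝ) + r) = (r.ascFactorial n : ℕ) := by
    rw [Nat.ascFactorial_eq_prod_range]
    push_cast
    exact prod_congr rfl fun i _ => add_comm _ _
  have h2 : r.ascFactorial n ≤ n.factorial * (n + r) ^ r := by
    rw [Nat.ascFactorial_eq_factorial_mul_choose']
    refine Nat.mul_le_mul_left _ ?_
    rw [Nat.choose_symm_of_eq_add (show r + n - 1 = n + (r - 1) by omega)]
    refine (Nat.choose_le_pow _ _).trans ?_
    exact (Nat.pow_le_pow_left (by omega) _).trans (Nat.pow_le_pow_right (by omega) (by omega))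
  have hf : (0 : ℝ) < n.factorial := by exact_mod_cast n.factorial_pos
  have hr' : (0 : ℝ) < r := by exact_mod_cast hr
  rw [h1]
  calc logb 2 ((r.ascFactorial n : ℕ) : ℝ) ≤ logb 2 ((n.factorial : ℝ) * ((n : ℝ) + r) ^ r) := by
        refine logb_le_logb_of_le one_lt_two ?_ (by exact_mod_cast h2)
        obtain ⟨r', rfl⟩ := Nat.exists_eq_succ_of_ne_zero hr.ne'
        exact_mod_cast Nat.ascFactorial_pos _ _
    _ = _ := by rw [logb_mul hf.ne' (by positivity), logb_pow]

/-- The factor `i = 0` is `r` and the others are at least `σ * i`. Compared with `σ ^ t * t!`, only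
the ratio `σ * t / r` is lost: the price of a new character. -/
theorem factorial_mul_le_rising {σ r t : ℕ} (ht : 0 < t) :
    r * (σ ^ t * t.factorial) ≤ (σ * t) * ∏ i ∈ range t, (σ * i + r) := by
  induction t, ht using Nat.le_induction with
  | base => simp; nlinarith
  | succ t ht ih =>
    rw [prod_range_succ, Nat.factorial_succ, pow_succ]
    have ht' : 0 < t := ht
    have h1 : σ * t ≤ σ * t + r := Nat.le_add_right _ _
    refine Nat.le_of_mul_le_mul_left ?_ ht'
    calc t * (r * (σ ^ t * σ * ((t + 1) * t.factorial)))
        = (r * (σ ^ t * t.factorial)) * ((t + 1) * (σ * t)) := by ring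
      _ ≤ (σ * t * ∏ i ∈ range t, (σ * i + r)) * ((t + 1) * (σ * t + r)) :=
          Nat.mul_le_mul ih (Nat.mul_le_mul_left _ h1)
      _ = _ := by ring

theorem log_rising_ge {σ r t : ℕ} (hr : 0 < r) (hrσ : r ≤ σ) :
    t * logb 2 σ + logb 2 (t.factorial : ℝ) - (if t = 0 then 0 else logb 2 ((σ * t : ℝ) / r)) ≤
      logb 2 (∏ i ∈ range t, ((σ : ℝ) * i + r)) := by
  split_ifs with h
  · simp [h]
  · have ht : 0 < t := Nat.pos_of_ne_zero h
    have hσ : (0 : ℝ) < σ := by exact_mod_cast hr.trans_le hrσ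
    have hr' : (0 : ℝ) < r := by exact_mod_cast hr
    have ht' : (0 : ℝ) < t := by exact_mod_cast ht
    have hf : (0 : ℝ) < t.factorial := by exact_mod_cast t.factorial_pos
    have h1 : (r : ℝ) * ((σ : ℝ) ^ t * t.factorial) ≤
        (σ * t) * ∏ i ∈ range t, ((σ : ℝ) * i + r) := by
      exact_mod_cast factorial_mul_le_rising (σ := σ) (r := r) ht
    have hp : (0 : ℝ) < ∏ i ∈ range t, ((σ : ℝ) * i + r) := prod_pos fun i _ => by positivity
    have h2 := logb_le_logb_of_le one_lt_two (by positivity) h1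
    rw [logb_mul hr'.ne' (by positivity), logb_mul (by positivity) hf.ne', logb_pow,
      logb_mul (by positivity) hp.ne'] at h2
    rw [logb_div (by positivity) hr'.ne']
    linarith

/-- The cost of a context exceeds its empirical entropy by the cost of the new characters. -/
theorem neg_log_urnProb_le {σ r : ℕ} (hr : 0 < r) (hrσ : r ≤ σ) (t : Fin σ → ℕ) :
    -logb 2 (urnProb r t) ≤ countEntropy t + r * logb 2 ((∑ a, t a : ℕ) + r) +
      ∑ a, if t a = 0 then 0 else logb 2 ((σ * t a : ℝ) / r) := by
  have hσ : (0 : ℝ) < σ := by exact_mod_cast hr.trans_le hrσ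
  have hr' : (0 : ℝ) < r := by exact_mod_cast hr
  set n := ∑ a, t a with hn
  have hp : ∀ a, (0 : ℝ) < ∏ i ∈ range (t a), ((σ : ℝ) * i + r) := fun a =>
    prod_pos fun i _ => by positivity
  have hq : (0 : ℝ) < ∏ i ∈ range n, ((i : ℝ) + r) := prod_pos fun i _ => by positivity
  have h1 : ∏ i ∈ range n, ((σ : ℝ) * (i + r)) = (σ : ℝ) ^ n * ∏ i ∈ range n, ((i : ℝ) + r) := by
    rw [prod_mul_distrib, prod_const, card_range]
  have h2 : -logb 2 (urnProb r t) = n * logb 2 σ + logb 2 (∏ i ∈ range n, ((i : ℝ) + r)) -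
      ∑ a, logb 2 (∏ i ∈ range (t a), ((σ : ℝ) * i + r)) := by
    unfold urnProb
    rw [← hn, h1, logb_div (prod_pos fun a _ => hp a).ne' (by positivity),
      logb_prod _ _ fun a _ => (hp a).ne', logb_mul (by positivity) hq.ne', logb_pow]
    ring
  -- The terms `t a * log σ` sum to the `n * log σ` of the denominator, so they cancel.
  have h3 := sum_le_sum fun a (_ : a ∈ univ) => log_rising_ge (t := t a) hr hrσ
  rw [sum_sub_distrib, sum_add_distrib, ← sum_mul, ← Nat.cast_sum, ← hn] at h3
  have h4 := log_rising_le hr n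
  have h5 := log_factorial_le t
  rw [← hn] at h5
  rw [h2]
  linarith

/-- The new characters are paid for by the factor `lam`, but for `c * r` frequent ones. -/
theorem exists_frequent_bound (lam : ℝ) (hlam : 1 ≤ lam) : ∃ c : ℕ, ∀ (σ r : ℕ), 0 < r → r ≤ σ →
    (σ : ℝ) ^ (1 / lam) ≤ r → ∀ t : Fin σ → ℕ,
    ∑ a, (if t a = 0 then 0 else logb 2 ((σ * t a : ℝ) / r)) ≤
      (lam - 1) * countEntropy t + c * r * logb 2 (σ * ((∑ a, t a : ℕ) + r)) := by
  -- With this `c`, the share `(λ - 1) log c` of each occurrence pays for `log (t a) ≤ t a`.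
  obtain ⟨c, hc⟩ : ∃ c : ℕ, 1 ≤ c ∧ (1 < lam → 1 ≤ (lam - 1) * logb 2 c) := by
    rcases hlam.eq_or_lt with h | h
    · exact ⟨1, le_rfl, fun h' => absurd h' (by linarith)⟩
    · refine ⟨⌈(2 : ℝ) ^ (1 / (lam - 1))⌉₊ + 1, by omega, fun _ => ?_⟩
      have h1 : (2 : ℝ) ^ (1 / (lam - 1)) ≤ ((⌈(2 : ℝ) ^ (1 / (lam - 1))⌉₊ + 1 : ℕ) : ℝ) := by
        push_cast
        have := Nat.le_ceil ((2 : ℝ) ^ (1 / (lam - 1)))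
        linarith
      have h2 := logb_le_logb_of_le one_lt_two (by positivity) h1
      rw [logb_rpow (by norm_num) (by norm_num)] at h2
      calc (1 : ℝ) = (lam - 1) * (1 / (lam - 1)) := by
            rw [mul_one_div_cancel (by linarith)]
        _ ≤ _ := mul_le_mul_of_nonneg_left h2 (by linarith)
  refine ⟨c, fun σ r hr hrσ hroot t => ?_⟩
  have hσ : (0 : ℝ) < σ := by exact_mod_cast hr.trans_le hrσ
  have hσ1 : (1 : ℝ) ≤ σ := by exact_mod_cast hr.trans_le hrσ
  have hr' : (0 : ℝ) < r := by exact_mod_cast hr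
  have hr1 : (1 : ℝ) ≤ r := by exact_mod_cast hr
  have hc1 : (1 : ℝ) ≤ c := by exact_mod_cast hc.1
  have hc0 : (0 : ℝ) < c := by linarith
  set n := ∑ a, t a with hn
  set M := logb 2 ((σ : ℝ) * ((n : ℝ) + r)) with hM
  have hM0 : 0 ≤ M := logb_nonneg one_lt_two (by
    have : (0 : ℝ) ≤ n := Nat.cast_nonneg n
    nlinarith)
  have htn : ∀ a, t a ≤ n := fun a => single_le_sum (f := t) (fun _ _ => Nat.zero_le _) (mem_univ a)
  have hterm : ∀ a, t a ≠ 0 → logb 2 ((σ * t a : ℝ) / r) ≤ M := by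
    intro a ha
    have h1 : (0 : ℝ) < t a := by exact_mod_cast Nat.pos_of_ne_zero ha
    refine logb_le_logb_of_le one_lt_two (by positivity) ?_
    rw [div_le_iff₀ hr']
    have h2 : (t a : ℝ) ≤ n := by exact_mod_cast htn a
    have h3 : (0 : ℝ) ≤ n := Nat.cast_nonneg n
    have h4 : (t a : ℝ) ≤ (n + r) * r := by nlinarith
    calc (σ : ℝ) * t a ≤ σ * ((n + r) * r) := mul_le_mul_of_nonneg_left h4 hσ.le
      _ = _ := by ring
  -- For `λ = 1` there is no surplus entropy, but then `r = σ` and every character may be charged to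
  -- the overhead.
  rcases hlam.eq_or_lt with h | h
  · subst h
    rw [sub_self, zero_mul, zero_add]
    have hrσ' : (r : ℝ) = σ := le_antisymm (by exact_mod_cast hrσ) (by simpa using hroot)
    calc ∑ a, (if t a = 0 then 0 else logb 2 ((σ * t a : ℝ) / r)) ≤ ∑ _a : Fin σ, M := by
          refine sum_le_sum fun a _ => ?_
          split_ifs with ha
          · exact hM0
          · exact hterm a ha
      _ = r * M := by simp [hrσ']
      _ ≤ c * r * M := by
          rw [mul_assoc]
          exact le_mul_of_one_le_left (by positivity) hc1
  · set F : Finset (Fin σ) := univ.filter fun a => t a ≠ 0 ∧ n ≤ t a * (c * r) with hF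
    have hcard : (F.card : ℝ) ≤ c * r := by
      rcases F.eq_empty_or_nonempty with h0 | ⟨a, ha⟩
      · rw [h0]
        simp
        positivity
      · have hn0 : 0 < n := (Nat.pos_of_ne_zero (mem_filter.1 ha).2.1).trans_le (htn a)
        have h1 : F.card * n ≤ (c * r) * n := by
          calc F.card * n = ∑ _a ∈ F, n := by simp
            _ ≤ ∑ a ∈ F, t a * (c * r) := sum_le_sum fun a ha => (mem_filter.1 ha).2.2
            _ ≤ ∑ a, t a * (c * r) := sum_le_sum_of_subset (subset_univ F)
            _ = _ := by rw [← sum_mul, mul_comm]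
        exact_mod_cast Nat.le_of_mul_le_mul_right h1 hn0
    -- This is where `r ≥ σ ^ (1 / λ)` is used: it says `λ log r ≥ log σ`.
    have hlr : (lam - 1) * logb 2 r ≥ logb 2 (σ / r) := by
      have h1 := logb_le_logb_of_le one_lt_two (by positivity) hroot
      rw [logb_rpow_eq_mul_logb_of_pos hσ] at h1
      rw [logb_div hσ.ne' hr'.ne']
      have h2 : lam * (1 / lam * logb 2 σ) ≤ lam * logb 2 r :=
        mul_le_mul_of_nonneg_left h1 (by linarith)
      rw [← mul_assoc, mul_one_div_cancel (by linarith), one_mul] at h2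
      linarith
    have hlr0 : 0 ≤ logb 2 (σ / r : ℝ) :=
      logb_nonneg one_lt_two ((one_le_div hr').2 (by exact_mod_cast hrσ))
    have hterm' : ∀ a, (if t a = 0 then 0 else logb 2 ((σ * t a : ℝ) / r)) ≤
        (lam - 1) * ((t a : ℝ) * logb 2 ((n : ℝ) / t a)) + if a ∈ F then M else 0 := by
      intro a
      have h0 := countEntropy_term_nonneg t a
      rw [← hn] at h0
      have h0' := mul_nonneg (show 0 ≤ lam - 1 by linarith) h0
      by_cases ha : t a = 0
      · rw [if_pos ha]
        split_ifs <;> linarith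
      · rw [if_neg ha]
        by_cases haF : a ∈ F
        · rw [if_pos haF]
          have := hterm a ha
          linarith
        · rw [if_neg haF, add_zero]
          have hlt : t a * (c * r) < n := by
            by_contra hle
            exact haF (mem_filter.2 ⟨mem_univ _, ha, by omega⟩)
          have hlt' : (t a : ℝ) * (c * r) < n := by exact_mod_cast hlt
          have hta : (1 : ℝ) ≤ t a := by exact_mod_cast Nat.pos_of_ne_zero ha
          have h1 : logb 2 (c * r : ℝ) ≤ logb 2 ((n : ℝ) / t a) := by
            refine logb_le_logb_of_le one_lt_two (by positivity) ?_
            rw [le_div_iff₀ (by linarith)]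
            linarith
          rw [logb_mul hc0.ne' hr'.ne'] at h1
          have h2 : logb 2 (t a : ℝ) ≤ t a := by
            rw [logb_le_iff_le_rpow one_lt_two (by linarith), rpow_natCast]
            exact_mod_cast Nat.lt_two_pow_self.le
          have h3 : logb 2 ((σ * t a : ℝ) / r) = logb 2 (σ / r : ℝ) + logb 2 (t a : ℝ) := by
            rw [← logb_mul (by positivity) (by linarith)]
            congr 1
            ring
          have h4 : (t a : ℝ) * (1 + logb 2 (σ / r : ℝ)) ≤
              (lam - 1) * ((t a : ℝ) * logb 2 ((n : ℝ) / t a)) := by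
            have h5 : 1 + logb 2 (σ / r : ℝ) ≤ (lam - 1) * logb 2 ((n : ℝ) / t a) := by
              have h6 := mul_le_mul_of_nonneg_left h1 (show 0 ≤ lam - 1 by linarith)
              have h7 := hc.2 h
              linarith
            calc _ ≤ (t a : ℝ) * ((lam - 1) * logb 2 ((n : ℝ) / t a)) :=
                  mul_le_mul_of_nonneg_left h5 (by linarith)
              _ = _ := by ring
          rw [h3]
          nlinarith
    calc _ ≤ ∑ a, ((lam - 1) * ((t a : ℝ) * logb 2 ((n : ℝ) / t a)) + if a ∈ F then M else 0) :=
          sum_le_sum fun a _ => hterm' a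
      _ = (lam - 1) * countEntropy t + F.card * M := by
          rw [sum_add_distrib, ← mul_sum, countEntropy, ← hn]
          simp
      _ ≤ _ := by
          have := mul_le_mul_of_nonneg_right hcard hM0
          linarith

/-! ### The length of the code -/

/-- Per context, the entropy itself and the share `λ - 1` for new characters add up to `λ`; the
overhead is summed over the `σ ^ k` contexts. -/
theorem neg_log_strProb_le {lam : ℝ} {c σ r k n : ℕ} (hr : 0 < r) (hrσ : r ≤ σ)
    (hc : ∀ t : Fin σ → ℕ, ∑ a, (if t a = 0 then 0 else logb 2 ((σ * t a : ℝ) / r)) ≤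
      (lam - 1) * countEntropy t + c * r * logb 2 (σ * ((∑ a, t a : ℕ) + r)))
    (s : List (Fin σ)) (hs : s.length ≤ n) :
    -logb 2 (strProb r k s) ≤ lam * contextEntropy k s +
      (σ : ℝ) ^ k * ((c + 1) * r * logb 2 (σ * (n + r))) := by
  have hσ : 0 < σ := hr.trans_le hrσ
  have hσ1 : (1 : ℝ) ≤ σ := by exact_mod_cast hσ
  have hr1 : (1 : ℝ) ≤ r := by exact_mod_cast hr
  rw [strProb_eq_prod, logb_prod _ _ fun w _ => (urnProb_pos hσ hr _).ne', ← sum_neg_distrib]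
  have h1 : ∀ w : Fin k → Fin σ, -logb 2 (urnProb r (followCount (List.ofFn w) s)) ≤
      lam * countEntropy (followCount (List.ofFn w) s) + (c + 1) * r * logb 2 (σ * (n + r)) := by
    intro w
    set t := followCount (List.ofFn w) s with ht
    have h2 := neg_log_urnProb_le hr hrσ t
    have h3 := hc t
    have h4 : ((∑ a, t a : ℕ) : ℝ) ≤ n := by
      exact_mod_cast (sum_followCount_le (List.ofFn w) s).trans hs
    have h5 : (0 : ℝ) ≤ ((∑ a, t a : ℕ) : ℝ) := Nat.cast_nonneg _
    have h6 : logb 2 (((∑ a, t a : ℕ) : ℝ) + r) ≤ logb 2 (σ * (n + r)) := by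
      refine logb_le_logb_of_le one_lt_two (by linarith) ?_
      nlinarith
    have h7 : logb 2 (σ * (((∑ a, t a : ℕ) : ℝ) + r)) ≤ logb 2 (σ * (n + r)) :=
      logb_le_logb_of_le one_lt_two (by positivity)
        (mul_le_mul_of_nonneg_left (by linarith) (by linarith))
    have h8 := mul_le_mul_of_nonneg_left h6 (show (0 : ℝ) ≤ r by linarith)
    have h9 := mul_le_mul_of_nonneg_left h7 (show (0 : ℝ) ≤ c * r by positivity)
    linarith
  refine (sum_le_sum fun w _ => h1 w).trans ?_
  rw [sum_add_distrib, ← mul_sum, contextEntropy]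
  simp

/-- The term `k * log σ` pays for the characters without a full context, and `log (B + 1)` for the
length stored with the rank. -/
theorem log_blockIndex_le {lam : ℝ} {c σ r k B : ℕ} (hr : 0 < r) (hrσ : r ≤ σ)
    (hc : ∀ t : Fin σ → ℕ, ∑ a, (if t a = 0 then 0 else logb 2 ((σ * t a : ℝ) / r)) ≤
      (lam - 1) * countEntropy t + c * r * logb 2 (σ * ((∑ a, t a : ℕ) + r)))
    (s : List (Fin σ)) (hs : s.length ≤ B) :
    logb 2 ((blockIndex σ r k B (charStream s) : ℝ) + 1) ≤ lam * contextEntropy k s +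
      (σ : ℝ) ^ k * ((c + 1) * r * logb 2 (σ * (B + r))) + k * logb 2 σ + logb 2 (B + 1) := by
  have hσ : 0 < σ := hr.trans_le hrσ
  have hσ0 : (0 : ℝ) < σ := by exact_mod_cast hσ
  have hσ1 : (1 : ℝ) ≤ σ := by exact_mod_cast hσ
  obtain ⟨n, hn, hnk⟩ : ∃ n, n + (s.length - k) = s.length ∧ n ≤ k :=
    ⟨s.length - (s.length - k), by omega, by omega⟩
  set ρ := rank σ r (σ ^ k) (s.length - k) (σ ^ s.length) (strVal s) with hρ
  have hp : 0 < strProb r k s := prob_pos hσ hr _ _ _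
  have h1 : ((ρ : ℝ) + 1) * strProb r k s ≤ (σ : ℝ) ^ k := by
    have := rank_succ_mul_prob_le (K := σ ^ k) (m := s.length - k) (n := n) (x := strVal s) hσ hr
      (by rw [hn]; exact strVal_lt s)
    rw [hn] at this
    exact this.trans (pow_le_pow_right₀ hσ1 hnk)
  have h2 : (blockIndex σ r k B (charStream s) : ℝ) + 1 ≤ ((ρ : ℝ) + 1) * (B + 1) := by
    have : blockIndex σ r k B (charStream s) + 1 ≤ (ρ + 1) * (B + 1) := by
      unfold blockIndex
      rw [charStream_length]
      change ρ * (B + 1) + s.length + 1 ≤ _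
      linarith
    exact_mod_cast this
  have h3 : logb 2 ((ρ : ℝ) + 1) + logb 2 (strProb r k s) ≤ k * logb 2 σ := by
    rw [← logb_mul (by positivity) hp.ne', ← logb_pow]
    exact logb_le_logb_of_le one_lt_two (by positivity) h1
  have h4 := logb_le_logb_of_le one_lt_two (by positivity) h2
  rw [logb_mul (by positivity) (by positivity)] at h4
  have h5 := neg_log_strProb_le (k := k) hr hrσ hc s hs
  linarith

theorem length_codeword (g z : ℕ) : (codeword g z).length =
    Nat.clog (2 ^ g) (z + 1) * g + Nat.clog (2 ^ g) (z + 1) + 1 := by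
  simp [codeword, length_digitsBE]
  ring

/-- Rounding up to whole groups wastes at most `g` bits; the unary part has one bit per group and a
terminator. -/
theorem length_codeword_le {g : ℕ} (hg : 0 < g) (z : ℕ) :
    ((codeword g z).length : ℝ) ≤ logb 2 ((z : ℝ) + 1) + g + logb 2 ((z : ℝ) + 1) / g + 2 := by
  have hb : 1 < 2 ^ g := Nat.one_lt_two_pow hg.ne'
  have hg' : (0 : ℝ) < g := by exact_mod_cast hg
  rw [length_codeword]
  set j := Nat.clog (2 ^ g) (z + 1) with hj
  have h0 : 0 ≤ logb 2 ((z : ℝ) + 1) := logb_nonneg one_lt_two (by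
    have : (0 : ℝ) ≤ z := Nat.cast_nonneg z
    linarith)
  have h1 : (j : ℝ) * g ≤ logb 2 ((z : ℝ) + 1) + g := by
    rcases Nat.eq_zero_or_pos j with h | h
    · rw [h]
      push_cast
      linarith
    · obtain ⟨i, hi⟩ := Nat.exists_eq_succ_of_ne_zero h.ne'
      have h2 : (2 ^ g) ^ i < z + 1 := (Nat.lt_clog_iff_pow_lt hb).1 (by omega)
      rw [← pow_mul] at h2
      have h3 : (2 : ℝ) ^ (g * i) ≤ (z : ℝ) + 1 := by exact_mod_cast h2.le
      have h4 := logb_le_logb_of_le one_lt_two (by positivity) h3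
      rw [logb_pow, logb_self_eq_one one_lt_two, mul_one] at h4
      rw [hi]
      push_cast at h4 ⊢
      linarith
  have h2 : (j : ℝ) ≤ logb 2 ((z : ℝ) + 1) / g + 1 := by
    rw [div_add_one hg'.ne', le_div_iff₀ hg']
    exact h1
  push_cast
  linarith

/-- A full block absorbs its overhead `E` in `mu * B`, so only the last block leaves an `E`;
superadditivity joins the entropies. -/
theorem length_encodeBlocks_le {σ k B : ℕ} {lam mu E : ℝ} (hB : 0 < B)
    (code : List ℕ → List Bool) (hE : E ≤ mu * B) (hmu : 0 ≤ mu) (hlam : 0 ≤ lam)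
    (hcode : ∀ s : List (Fin σ), s.length ≤ B →
      ((code (charStream s)).length : ℝ) ≤ lam * contextEntropy k s + E)
    (s : List (Fin σ)) :
    ((encodeBlocks B code (charStream s)).length : ℝ) ≤
      lam * contextEntropy k s + mu * s.length + E := by
  induction hn : s.length using Nat.strong_induction_on generalizing s with
  | _ n ih =>
    subst hn
    rw [encodeBlocks, charStream_length]
    split_ifs with h
    · have h1 : (charStream s).take B = charStream (s.take B) := by
        simp [charStream_eq_map]
      have h2 : (charStream s).drop B = charStream (s.drop B) := by
        simp [charStream_eq_map]
      have h3 : (s.take B).length = B := by simp [h.2]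
      have h4 := hcode (s.take B) h3.le
      have h5 := ih (s.drop B).length (by rw [List.length_drop]; omega) (s.drop B) rfl
      have h6 := contextEntropy_add_le k (s.take B) (s.drop B)
      rw [List.take_append_drop] at h6
      have h7 : (s.length : ℝ) = B + (s.drop B).length := by
        rw [List.length_drop, Nat.cast_sub h.2]
        ring
      have h8 := mul_le_mul_of_nonneg_left h6 hlam
      rw [h1, h2, List.length_append]
      push_cast
      rw [h7]
      linarith
    · have h1 := hcode s (by omega)
      have h2 : 0 ≤ mu * s.length := by positivity
      linarith

theorem size_le_self (σ : ℕ) : σ.size ≤ σ := by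
  rw [Nat.size_le]
  exact Nat.lt_two_pow_self

/-- The block length is polynomial in `σ`, so `log (σ * (B + r))` is `O(log σ)` for fixed `k` and
`A`. -/
theorem alphabet_mul_block_le {k A σ r : ℕ} (hA : 0 < A) (hσ : 2 ≤ σ) (hrσ : r ≤ σ) :
    σ * (blockSize k A σ r + r) ≤ 2 ^ ((k + 6) * A * σ.size) := by
  have hL : 1 ≤ σ.size := Nat.size_pos.2 (by omega)
  have hA2 : 1 ≤ A ^ 2 := Nat.one_le_pow _ _ hA
  have h1 : blockSize k A σ r ≤ A ^ 2 * σ ^ (k + 2) := by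
    unfold blockSize
    refine Nat.mul_le_mul_left _ ?_
    rw [pow_add, pow_two, mul_assoc]
    exact Nat.mul_le_mul_left _ (Nat.mul_le_mul hrσ (size_le_self σ))
  have h2 : r ≤ A ^ 2 * σ ^ (k + 2) := by
    calc r ≤ σ := hrσ
      _ ≤ σ ^ (k + 2) := Nat.le_self_pow (by omega) σ
      _ ≤ _ := Nat.le_mul_of_pos_left _ hA2
  calc σ * (blockSize k A σ r + r) ≤ σ * (A ^ 2 * σ ^ (k + 2) * σ) :=
        Nat.mul_le_mul_left _ (by nlinarith)
    _ = A ^ 2 * σ ^ (k + 4) := by ring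
    _ ≤ (2 ^ A) ^ 2 * (2 ^ σ.size) ^ (k + 4) :=
        Nat.mul_le_mul (Nat.pow_le_pow_left Nat.lt_two_pow_self.le _)
          (Nat.pow_le_pow_left (Nat.lt_size_self σ).le _)
    _ = 2 ^ (A * 2 + σ.size * (k + 4)) := by rw [← pow_mul, ← pow_mul, ← pow_add]
    _ ≤ _ := by
        refine Nat.pow_le_pow_right two_pos ?_
        have h3 : A ≤ A * σ.size := Nat.le_mul_of_pos_right _ hL
        have h4 : σ.size * (k + 4) ≤ A * σ.size * (k + 4) :=
          Nat.mul_le_mul_right _ (Nat.le_mul_of_pos_left _ hA)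
        nlinarith

/-- The overhead of the code of one block. -/
theorem length_block_le {lam : ℝ} {c σ r k A : ℕ} (hA : 0 < A) (hσ : 2 ≤ σ) (hr : 0 < r)
    (hrσ : r ≤ σ)
    (hc : ∀ t : Fin σ → ℕ, ∑ a, (if t a = 0 then 0 else logb 2 ((σ * t a : ℝ) / r)) ≤
      (lam - 1) * countEntropy t + c * r * logb 2 (σ * ((∑ a, t a : ℕ) + r)))
    (s : List (Fin σ)) (hs : s.length ≤ blockSize k A σ r) :
    ((codeword (groupSize k A σ r)
      (blockIndex σ r k (blockSize k A σ r) (charStream s))).length : ℝ) ≤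
      lam * contextEntropy k s + ((c + 1) * (k + 6) + k + (k + 6) + 6) * groupSize k A σ r := by
  set g := groupSize k A σ r with hg
  set B := blockSize k A σ r with hB
  set L := σ.size with hL
  have hL1 : 1 ≤ L := Nat.size_pos.2 (by omega)
  have hL1' : (1 : ℝ) ≤ L := by exact_mod_cast hL1
  have hA1 : (1 : ℝ) ≤ A := by exact_mod_cast hA
  have hK1 : 1 ≤ σ ^ k * r := Nat.mul_pos (Nat.pow_pos (by omega)) hr
  have hK1' : (1 : ℝ) ≤ (σ : ℝ) ^ k * r := by exact_mod_cast hK1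
  have hgA : (g : ℝ) = (σ : ℝ) ^ k * r * (A * L) := by
    rw [hg, groupSize]
    push_cast
    ring
  have hBg : (B : ℝ) = A * g := by
    rw [hB, blockSize, hgA]
    push_cast
    ring
  have hAL1 : (1 : ℝ) ≤ A * L := by nlinarith
  have hALg : (A : ℝ) * L ≤ g := by
    rw [hgA]
    exact le_mul_of_one_le_left (by positivity) hK1'
  have hg1 : (1 : ℝ) ≤ g := hAL1.trans hALg
  have hg0 : 0 < g := by exact_mod_cast lt_of_lt_of_le one_pos hg1
  have hB1 : (1 : ℝ) ≤ B := by rw [hBg]; nlinarith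
  have hσ1 : (1 : ℝ) ≤ σ := by exact_mod_cast (by omega : 1 ≤ σ)
  have hr1 : (1 : ℝ) ≤ r := by exact_mod_cast hr
  have hlogσ : logb 2 σ ≤ L := by
    rw [logb_le_iff_le_rpow one_lt_two (by linarith), rpow_natCast]
    exact_mod_cast (Nat.lt_size_self σ).le
  have hlogM : logb 2 (σ * ((B : ℝ) + r)) ≤ (k + 6) * (A * L) := by
    have h1 : (σ * ((B : ℝ) + r)) ≤ (2 : ℝ) ^ ((k + 6) * A * L) := by
      exact_mod_cast alphabet_mul_block_le hA hσ hrσ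
    have h2 := logb_le_logb_of_le one_lt_two (by positivity) h1
    rw [logb_pow, logb_self_eq_one one_lt_two, mul_one] at h2
    push_cast at h2
    linarith
  have hlogB : logb 2 ((B : ℝ) + 1) ≤ (k + 6) * (A * L) := by
    refine le_trans (logb_le_logb_of_le one_lt_two (by positivity) ?_) hlogM
    nlinarith
  set z := blockIndex σ r k B (charStream s) with hz
  have h1 := log_blockIndex_le (k := k) hr hrσ hc s hs
  have h2 := length_codeword_le hg0 z
  rw [← hz] at h1
  set Λ := logb 2 ((z : ℝ) + 1) with hΛ
  -- Trivially `Λ ≤ 3 * B * L`, and `B * L = A * g * L ≤ g ^ 2` since `A * L ≤ g`. Hence the unary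
  -- part is also within the overhead.
  have h3 : Λ / g ≤ 3 * g := by
    have h4 : z + 1 ≤ σ ^ B * 2 * (B + 1) := by
      have h5 := rank_le σ r (σ ^ k) ((charStream s).length - k) (σ ^ (charStream s).length)
        (numVal σ (charStream s))
      have h6 : σ ^ (charStream s).length ≤ σ ^ B :=
        Nat.pow_le_pow_right (by omega) (by rwa [charStream_length])
      have h7 : 1 ≤ σ ^ B := Nat.one_le_pow _ _ (by omega)
      have h8 : (charStream s).length ≤ B := by rwa [charStream_length]
      rw [hz, blockIndex]
      nlinarith [Nat.mul_le_mul_right (B + 1) (h5.trans h6), Nat.mul_le_mul_right (B + 1) h7]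
    have h5 : Λ ≤ logb 2 ((σ : ℝ) ^ B * 2 * (B + 1)) :=
      logb_le_logb_of_le one_lt_two (by positivity) (by exact_mod_cast h4)
    rw [logb_mul (by positivity) (by positivity), logb_mul (by positivity) two_ne_zero, logb_pow,
      logb_self_eq_one one_lt_two] at h5
    have h6 : logb 2 ((B : ℝ) + 1) ≤ B := by
      rw [logb_le_iff_le_rpow one_lt_two (by positivity), rpow_natCast]
      exact_mod_cast Nat.lt_two_pow_self
    have h7 : (B : ℝ) * logb 2 σ ≤ B * L := mul_le_mul_of_nonneg_left hlogσ (by linarith)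
    have h8 : (B : ℝ) ≤ B * L := le_mul_of_one_le_right (by linarith) hL1'
    rw [div_le_iff₀ (by linarith)]
    have h9 : Λ ≤ 3 * (B * L) := by linarith
    have h10 : (B : ℝ) * L ≤ g * g := by
      rw [hBg]
      calc (A : ℝ) * g * L = (A * L) * g := by ring
        _ ≤ g * g := mul_le_mul_of_nonneg_right hALg (by linarith)
    linarith
  have h4 : (σ : ℝ) ^ k * ((c + 1) * r * logb 2 (σ * (B + r))) ≤ (c + 1) * (k + 6) * g := by
    calc (σ : ℝ) ^ k * ((c + 1) * r * logb 2 (σ * (B + r)))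
        = ((c + 1) * ((σ : ℝ) ^ k * r)) * logb 2 (σ * (B + r)) := by ring
      _ ≤ ((c + 1) * ((σ : ℝ) ^ k * r)) * ((k + 6) * (A * L)) :=
          mul_le_mul_of_nonneg_left hlogM (by positivity)
      _ = _ := by rw [hgA]; ring
  have h5 : (k : ℝ) * logb 2 σ ≤ k * g := by
    refine mul_le_mul_of_nonneg_left ?_ (Nat.cast_nonneg k)
    nlinarith
  have h6 : logb 2 ((B : ℝ) + 1) ≤ (k + 6) * g :=
    hlogB.trans (mul_le_mul_of_nonneg_left hALg (by positivity))
  -- The final 6 in the constant covers `g + 3 * g + 2` from the codeword; the other summands are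
  -- `h4`, `h5` and `h6`.
  linarith

/-! ### The bounds on memory -/

/-- A bound on the registers of the two programs. -/
def regBound (M k A σ r : ℕ) : ℕ :=
  M * (2 ^ groupSize k A σ r *
    (((σ * (blockSize k A σ r + r)) ^ blockSize k A σ r + 1) * (blockSize k A σ r + 1)))

/-- The factor `M` is not needed here; it makes room for the constants in the program text. -/
theorem bounds_regBound {M k A σ r : ℕ} (hM : 0 < M) (hA : 0 < A) (hσ : 2 ≤ σ) (hr : 0 < r) :
    Bounds (regBound M k A σ r) σ r (groupSize k A σ r) (blockSize k A σ r) := by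
  have hu : 0 < σ ^ k * r * σ.size :=
    Nat.mul_pos (Nat.mul_pos (Nat.pow_pos (by omega)) hr) (Nat.size_pos.2 (by omega))
  exact ⟨hσ, hr, Nat.mul_pos hA hu, Nat.mul_pos (Nat.pow_pos hA) hu, Nat.le_mul_of_pos_left _ hM⟩

/-- The power `(σ * (B + r)) ^ B` dominates, with `O(B log σ)` bits. -/
theorem size_regBound_le {M k A σ r : ℕ} (hM : 0 < M) (hA : 0 < A) (hσ : 2 ≤ σ) (hr : 0 < r)
    (hrσ : r ≤ σ) :
    (regBound M k A σ r).size ≤ (M + 4 + (k + 6) * A) * (blockSize k A σ r * σ.size) := by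
  have hb := bounds_regBound (k := k) hM hA hσ hr
  have hB := hb.B_pos
  set B := blockSize k A σ r with hBdef
  set g := groupSize k A σ r with hgdef
  set L := σ.size with hL
  have hL1 : 1 ≤ L := Nat.size_pos.2 (by omega)
  have hgB : g ≤ B := by
    rw [hgdef, hBdef, groupSize, blockSize]
    exact Nat.mul_le_mul_right _ (Nat.le_self_pow two_ne_zero A)
  set e := (k + 6) * A * L with he
  have h1 : (σ * (B + r)) ^ B ≤ 2 ^ (e * B) := by
    rw [pow_mul]
    exact Nat.pow_le_pow_left (alphabet_mul_block_le hA hσ hrσ) _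
  have h2 : (σ * (B + r)) ^ B + 1 ≤ 2 ^ (e * B + 1) := by
    rw [pow_succ]
    have := Nat.one_le_two_pow (n := e * B)
    omega
  have h3 : B + 1 ≤ 2 ^ B := Nat.lt_two_pow_self
  rw [Nat.size_le]
  calc regBound M k A σ r ≤ 2 ^ M * (2 ^ g * (2 ^ (e * B + 1) * 2 ^ B)) :=
        Nat.mul_le_mul Nat.lt_two_pow_self.le (Nat.mul_le_mul_left _ (Nat.mul_le_mul h2 h3))
    _ = 2 ^ (M + (g + (e * B + 1 + B))) := by rw [← pow_add, ← pow_add, ← pow_add]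
    _ < _ := by
        refine Nat.pow_lt_pow_right one_lt_two ?_
        have h4 : 1 ≤ B * L := Nat.mul_pos hB hL1
        have h5 : B ≤ B * L := Nat.le_mul_of_pos_right _ hL1
        have h6 : M ≤ M * (B * L) := Nat.le_mul_of_pos_right _ h4
        have h7 : e * B = (k + 6) * A * (B * L) := by rw [he]; ring
        rw [h7, add_mul (M + 4), add_mul M]
        omega

theorem init_le {N σ r : ℕ} (hσ : σ ≤ N) (hr : r ≤ N) : ∀ j, Mem.init 25 [σ, r] j ≤ N := by
  rw [init_eq_mem]
  refine St.mem_le ?_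
  simp [hσ, hr]

/-- The size of the tables in terms of the alphabet. -/
theorem table_le {lam : ℝ} (hlam : 1 ≤ lam) (k : ℕ) {σ : ℕ} (hσ : 2 ≤ σ) :
    ((σ ^ k * ⌈(σ : ℝ) ^ (1 / lam)⌉₊ * σ.size : ℕ) : ℝ) ≤
      4 * ((σ : ℝ) ^ ((k : ℝ) + 1 / lam) * logb 2 σ) ∧ (σ.size : ℝ) ≤ 2 * logb 2 σ := by
  have hσ1 : (1 : ℝ) ≤ σ := by exact_mod_cast (by omega : 1 ≤ σ)
  have hσ0 : (0 : ℝ) < σ := by linarith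
  have hlog1 : 1 ≤ logb 2 (σ : ℝ) := by
    rw [le_logb_iff_rpow_le one_lt_two hσ0, rpow_one]
    exact_mod_cast hσ
  have hsize : (σ.size : ℝ) ≤ 2 * logb 2 σ := by
    obtain ⟨l, hl⟩ := Nat.exists_eq_succ_of_ne_zero (Nat.size_pos.2 (by omega : 0 < σ)).ne'
    have h1 : 2 ^ l ≤ σ := Nat.lt_size.1 (by omega)
    have h2 : (l : ℝ) ≤ logb 2 σ := by
      rw [le_logb_iff_rpow_le one_lt_two hσ0, rpow_natCast]
      exact_mod_cast h1
    rw [hl]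
    push_cast
    linarith
  refine ⟨?_, hsize⟩
  have hroot : 1 ≤ (σ : ℝ) ^ (1 / lam) := one_le_rpow hσ1 (by positivity)
  have hceil : (⌈(σ : ℝ) ^ (1 / lam)⌉₊ : ℝ) ≤ 2 * (σ : ℝ) ^ (1 / lam) := by
    have := Nat.ceil_lt_add_one (show 0 ≤ (σ : ℝ) ^ (1 / lam) by positivity)
    linarith
  push_cast
  rw [rpow_add hσ0, rpow_natCast]
  calc (σ : ℝ) ^ k * ⌈(σ : ℝ) ^ (1 / lam)⌉₊ * σ.size
      ≤ (σ : ℝ) ^ k * (2 * (σ : ℝ) ^ (1 / lam)) * (2 * logb 2 σ) := by gcongr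
    _ = _ := by ring

end OnePass

/-! ### The main theorem: choice of the constants -/

theorem mainTheorem2 (lam : ℝ) (hlam : 1 ≤ lam) (k : ℕ) (mu : ℝ) (hmu : 0 < mu) :
    ∃ (m : ℕ) (enc dec : OnePass.Prog m) (C : ℝ),
      ∀ σ : ℕ, 2 ≤ σ → ∀ s : List (Fin σ), ∃ code : List Bool,
        (code.length : ℝ) ≤ (lam * OnePass.entropy k s + mu) * (s.length : ℝ)
            + C * ((σ : ℝ) ^ ((k : ℝ) + 1 / lam) * Real.logb 2 (σ : ℝ)) ∧
        OnePass.Transforms enc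
          ⌊C * ((σ : ℝ) ^ ((k : ℝ) + 1 / lam) * Real.logb 2 (σ : ℝ) ^ 2)⌋₊
          [σ, ⌈(σ : ℝ) ^ (1 / lam)⌉₊]
          (OnePass.charStream s) (OnePass.bitStream code) ∧
        OnePass.Transforms dec
          ⌊C * ((σ : ℝ) ^ ((k : ℝ) + 1 / lam) * Real.logb 2 (σ : ℝ) ^ 2)⌋₊
          [σ, ⌈(σ : ℝ) ^ (1 / lam)⌉₊]
          (OnePass.bitStream code) (OnePass.charStream s) := by
  open OnePass in
  obtain ⟨c, hc⟩ := exists_frequent_bound lam hlam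
  set C₀ : ℝ := (c + 1) * (k + 6) + k + (k + 6) + 6 with hC₀
  have hC₀pos : 0 < C₀ := by positivity
  -- A block costs an overhead of `C₀ * g` bits and has length `A * g`, so this `A` hides the
  -- overhead in `mu` bits per character. It depends on `λ`, `k`, `μ` only, so it may enter the
  -- program text.
  obtain ⟨A, hA, hAmu⟩ : ∃ A : ℕ, 0 < A ∧ C₀ ≤ mu * A := by
    refine ⟨⌈C₀ / mu⌉₊, Nat.ceil_pos.2 (by positivity), ?_⟩
    rw [← div_le_iff₀' hmu]
    exact Nat.le_ceil _
  set D := max (encProg k A).cost (decProg k A).cost with hD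
  set M := max (encProg k A).maxConst (decProg k A).maxConst + 1 with hM
  -- The 4 here is that of `table_le`, from rounding up both the root and the logarithm; the 8 below
  -- has one more factor 2 from the second logarithm.
  set C₁ : ℝ := C₀ * A * 4 with hC₁
  set C₂ : ℝ := (25 + D) * (M + 4 + (k + 6) * A) * A ^ 2 * 8 with hC₂
  have hC₁0 : 0 ≤ C₁ := by positivity
  have hC₂0 : 0 ≤ C₂ := by positivity
  refine ⟨25, encProg k A, decProg k A, C₁ + C₂, fun σ hσ s => ?_⟩
  set r := ⌈(σ : ℝ) ^ (1 / lam)⌉₊ with hr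
  set g := groupSize k A σ r with hg
  set B := blockSize k A σ r with hB
  have hσ1 : (1 : ℝ) ≤ σ := by exact_mod_cast (by omega : 1 ≤ σ)
  have hσ0 : (0 : ℝ) < σ := by linarith
  have hr0 : 0 < r := Nat.ceil_pos.2 (by positivity)
  have hrσ : r ≤ σ := by
    refine Nat.ceil_le.2 ?_
    calc (σ : ℝ) ^ (1 / lam) ≤ (σ : ℝ) ^ (1 : ℝ) :=
          Real.rpow_le_rpow_of_exponent_le hσ1 ((div_le_one (by linarith)).2 hlam)
      _ = σ := Real.rpow_one _
  have hcr := hc σ r hr0 hrσ (Nat.le_ceil _)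
  have hb := bounds_regBound (M := M) (k := k) (Nat.succ_pos _) hA hσ hr0
  set N := regBound M k A σ r with hN
  obtain ⟨htab, hsize⟩ := table_le hlam k hσ
  rw [← hr] at htab
  set X := (σ : ℝ) ^ ((k : ℝ) + 1 / lam) with hX
  have hX0 : 0 < X := by positivity
  have hlog0 : 0 ≤ Real.logb 2 (σ : ℝ) := Real.logb_nonneg one_lt_two hσ1
  have hgX : (g : ℝ) ≤ A * (4 * (X * Real.logb 2 σ)) := by
    rw [hg, groupSize, Nat.cast_mul]
    exact mul_le_mul_of_nonneg_left htab (Nat.cast_nonneg A)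
  have hBX : (B : ℝ) ≤ A ^ 2 * (4 * (X * Real.logb 2 σ)) := by
    rw [hB, blockSize, Nat.cast_mul, Nat.cast_pow]
    exact mul_le_mul_of_nonneg_left htab (by positivity)
  have hBg : (B : ℝ) = A * g := by
    rw [hB, hg, blockSize, groupSize]
    push_cast
    ring
  have hmem : (25 + D) * N.size ≤ ⌊(C₁ + C₂) * (X * Real.logb 2 (σ : ℝ) ^ 2)⌋₊ := by
    refine Nat.le_floor ?_
    have h1 := size_regBound_le (M := M) (k := k) (Nat.succ_pos _) hA hσ hr0 hrσ
    rw [← hN, ← hB] at h1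
    have h2 : (N.size : ℝ) ≤ (M + 4 + (k + 6) * A) * (B * σ.size) := by exact_mod_cast h1
    have h3 : (B : ℝ) * σ.size ≤ (A ^ 2 * (4 * (X * Real.logb 2 σ))) * (2 * Real.logb 2 σ) :=
      mul_le_mul hBX hsize (Nat.cast_nonneg _) (by positivity)
    calc (((25 + D) * N.size : ℕ) : ℝ) = (25 + D) * N.size := by push_cast; ring
      _ ≤ (25 + D) * ((M + 4 + (k + 6) * A) *
          ((A ^ 2 * (4 * (X * Real.logb 2 σ))) * (2 * Real.logb 2 σ))) := by
          refine mul_le_mul_of_nonneg_left (h2.trans ?_) (by positivity)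
          exact mul_le_mul_of_nonneg_left h3 (by positivity)
      _ = C₂ * (X * Real.logb 2 (σ : ℝ) ^ 2) := by rw [hC₂]; ring
      _ ≤ _ := mul_le_mul_of_nonneg_right (by linarith) (by positivity)
  have hinit : ∀ j, Mem.init 25 [σ, r] j ≤ N := init_le hb.alphabet_le (hrσ.trans hb.alphabet_le)
  have h2N : 2 ≤ N := hσ.trans hb.alphabet_le
  have hMN : M ≤ N := Nat.le_mul_of_pos_right _ (by positivity)
  have hencM : (encProg k A).maxConst ≤ N := le_trans (by omega) hMN
  have hdecM : (decProg k A).maxConst ≤ N := le_trans (by omega) hMN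
  obtain ⟨v₁, i₁, henc⟩ := run_encProg hb (charStream s) (charStream_lt s)
  obtain ⟨v₂, i₂, hdec⟩ := run_decProg hb
    (fun m n x y hxy hy => rank_ne (by omega) hr0 hxy hy) (charStream s) (charStream_lt s)
  refine ⟨_, ?_, henc.transforms h2N hmem hinit (le_max_left _ _) hencM,
    hdec.transforms h2N hmem hinit (le_max_right _ _) hdecM⟩
  have hlen := length_encodeBlocks_le (k := k) (lam := lam) (mu := mu) (E := C₀ * g) hb.B_pos
    (fun l => codeword g (blockIndex σ r k B l)) ?_ hmu.le (by linarith)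
    (fun s hs => length_block_le hA hσ hr0 hrσ hcr s hs) s
  · have h1 : C₀ * g ≤ C₁ * (X * Real.logb 2 σ) := by
      calc C₀ * g ≤ C₀ * (A * (4 * (X * Real.logb 2 σ))) :=
            mul_le_mul_of_nonneg_left hgX hC₀pos.le
        _ = _ := by rw [hC₁]; ring
    have h2 : 0 ≤ C₂ * (X * Real.logb 2 σ) := by positivity
    have h3 := length_mul_entropy k s
    have h4 : (lam * entropy k s + mu) * (s.length : ℝ) =
        lam * contextEntropy k s + mu * s.length := by
      rw [← h3]
      ring
    rw [h4]
    linarith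
  · change C₀ * g ≤ mu * (B : ℝ)
    rw [hBg, ← mul_assoc]
    exact mul_le_mul_of_nonneg_right hAmu (Nat.cast_nonneg g)
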